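/- Let $\mathbb M$ be a complex surface (a Hausdorff complex manifold of complex dimension 2) with complex structure $\mathbb J$, and let $\Sigma\subset\mathbb M$ be a smoothly embedded real surface, that is, a smooth embedded real 2-dimensional submanifold without boundary. A point $\gamma\in\Sigma$ is a *complex point* if $\mathbb J(T_\gamma\Sigma)\subset T_\gamma\Sigma$; $\Sigma$ is *totally real* (at $p$) if $T_p\Sigma\cap\mathbb J(T_p\Sigma)=0$ (at $p$, resp. at all $p\in\Sigma$). The *index* $I_\Sigma(\gamma)\in\mathbb Z$ of an isolated complex point $\gamma$ is the winding number of $\partial F/\partial\bar\xi$ along small counterclockwise circles around $\xi(\gamma)$, where $(\xi,\eta)$ are local holomorphic coordinates of $\mathbb M$ at $\gamma$ in which $\Sigma$ is a smooth graph $\eta=F(\xi)$; it does not depend on the coordinates. An isolated complex point is *hyperbolic* if its index is $-1$. The *cross-cap* is $\mathbb RP^2$ with an open disc removed. Let $\gamma$ be a hyperbolic complex point of $\Sigma$. A *totally real blow-up* of $\Sigma$ at $\gamma$ inside $U\subset\mathbb M$ is a smoothly embedded real surface $\tilde\Sigma\subset\mathbb M$ of the form $\tilde\Sigma=(\Sigma\setminus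 D_0)\cup C$, where $D\subset\Sigma\cap U$ is an embedded closed disc whose open disc $D_0$ contains $\gamma$, $\gamma$ is the only complex point of $\Sigma$ in $D$, and $C\subset U$ is an embedded cross-cap with boundary circle $D\setminus D_0$, such that $C\cap(\Sigma\setminus D_0)=D\setminus D_0$ and $\tilde\Sigma$ is totally real at all points of $C$. Thus $\tilde\Sigma$ is the connected sum $\Sigma\#\mathbb RP^2$, obtained by replacing a disc around $\gamma$ by a cross-cap. **Proposition (totally real blow-up).** Let $\gamma$ be a hyperbolic complex point of the smoothly embedded real surface $\Sigma\subset\mathbb M$. 1. For every neighbourhood $U$ of $\gamma$ in $\mathbb M$ there is a totally real blow-up $\tilde\Sigma=\Sigma\#\mathbb RP^2$ of $\Sigma$ at $\gamma$ inside $U$. If $\gamma$ is the only complex point of $\Sigma$, then $\tilde\Sigma$ is a totally real embedded surface. 2. For every totally real blow-up $\tilde\Sigma$ of $\Sigma$ at $\gamma$ (inside any $U\subset\mathbb M$), the complex points of $\tilde\Sigma$ are exactly the complex points of $\Sigma$ other than $\gamma$, with the same indices. In particular, if $\Sigma$ has only finitely many complex points, then $$\sum_{p\ \text{complex point of }\tilde\Sigma}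 I_{\tilde\Sigma}(p)\;=\;\sum_{p\ \text{complex point of }\Sigma} I_\Sigma(p)\;+\;1 .$$ -/

import Mathlib

open Set Filter Topology
open scoped Manifold ContDiff

noncomputable section

namespace TotallyRealBlowup

/-! ### Real surfaces in a complex surface

A complex surface is a Hausdorff space `M` with charts in `ℂ × ℂ` and holomorphic transition maps. -/

section Surfaces

variable {M : Type*} [TopologicalSpace M] [ChartedSpace (ℂ × ℂ) M]

/-- `S ⊆ M` is a smoothly embedded real surface (without boundary): around each of its points there
is a chart of the underlying smooth real 4-manifold in which `S` is the real 2-plane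
`ℂ × {0} ⊆ ℂ × ℂ`. -/
def IsEmbeddedSurface (S : Set M) : Prop :=
  ∀ p ∈ S, ∃ φ ∈ IsManifold.maximalAtlas 𝓘(ℝ, ℂ × ℂ) ∞ M,
    p ∈ φ.source ∧ ∀ x ∈ φ.source, x ∈ S ↔ (φ x).2 = 0

/-- The tangent plane `T_p S`: velocities at time `0` of curves in `S` through `p`. The tangent
space `T_p M` is read in the preferred holomorphic chart at `p`, as Mathlib's `TangentSpace` is, so
that the complex structure of `T_p M` is multiplication by `i`. -/
def tangentPlane (S : Set M) (p : M) : Set (ℂ × ℂ) :=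
  {v | ∃ c : ℝ → M, c 0 = p ∧ ContinuousAt c 0 ∧ (∀ᶠ t in 𝓝 0, c t ∈ S) ∧
    HasDerivAt (fun t => chartAt (ℂ × ℂ) p (c t)) v 0}

/-- The complex points of `S`: the points `p` at which the complex structure preserves `T_p S`. -/
def complexPoints (S : Set M) : Set M :=
  {p | p ∈ S ∧ ∀ v ∈ tangentPlane S p, Complex.I • v ∈ tangentPlane S p}

/-- `S` is totally real at `p`: `T_p S ∩ i T_p S = 0`. -/
def IsTotallyRealAt (S : Set M) (p : M) : Prop :=
  ∀ v ∈ tangentPlane S p, Complex.I • v ∈ tangentPlane S p → v = 0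

/-- `S` is totally real. -/
def IsTotallyReal (S : Set M) : Prop :=
  ∀ p ∈ S, IsTotallyRealAt S p

/-! ### The index of a complex point -/

/-- The operator `∂/∂ξ̄ = (∂/∂x + i ∂/∂y) / 2`, for `ξ = x + i y`. -/
def dbar (F : ℂ → ℂ) (z : ℂ) : ℂ :=
  (fderiv ℝ F z 1 + Complex.I * fderiv ℝ F z Complex.I) / 2

/-- The loop `t ↦ g t`, `0 ≤ t ≤ 2π`, avoids `0` and winds `k` times around it: it has a continuous
logarithm, which increases by `2πik`. -/
def HasWindingNumber (g : ℝ → ℂ) (k : ℤ) : Prop :=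
  ∃ l : ℝ → ℂ, ContinuousOn l (Icc 0 (2 * Real.pi)) ∧
    (∀ t ∈ Icc 0 (2 * Real.pi), g t = Complex.exp (l t)) ∧
    l (2 * Real.pi) - l 0 = 2 * Real.pi * Complex.I * k

/-- `S` has index `k` at `p`: in local holomorphic coordinates `(ξ, η)` of `M` at `p` in which `S` is
a smooth graph `η = F(ξ)`, the function `∂F/∂ξ̄` has winding number `k` along all sufficiently small
circles, run through counterclockwise, around `ξ(p)`. At an isolated complex point such coordinates
exist, and `k` does not depend on them. -/
def HasComplexIndex (S : Set M) (p : M) (k : ℤ) : Prop :=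
  ∃ φ ∈ IsManifold.maximalAtlas 𝓘(ℂ, ℂ × ℂ) ω M, ∃ F : ℂ → ℂ,
    p ∈ φ.source ∧ (∀ᶠ z in 𝓝 (φ p).1, ContDiffAt ℝ ∞ F z) ∧
    (∀ᶠ x in 𝓝 p, x ∈ S ↔ (φ x).2 = F (φ x).1) ∧
    ∀ᶠ r : ℝ in 𝓝[>] 0,
      HasWindingNumber (fun t => dbar F ((φ p).1 + r * Complex.exp (t * Complex.I))) k

open Classical in
/-- The index of an isolated complex point `p` of `S` (and a default value at other points). -/
def complexIndex (S : Set M) (p : M) : ℤ :=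
  if h : ∃ k, HasComplexIndex S p k then h.choose else 0

/-- The sum of the indices of the complex points of `S` (meaningful if there are finitely many). -/
def complexIndexSum (S : Set M) : ℤ :=
  ∑ᶠ p ∈ complexPoints S, complexIndex S p

/-- A hyperbolic complex point: an isolated complex point of index `-1`. -/
def IsHyperbolicPoint (S : Set M) (γ : M) : Prop :=
  γ ∈ complexPoints S ∧ (∀ᶠ p in 𝓝[≠] γ, p ∉ complexPoints S) ∧ complexIndex S γ = -1

end Surfaces

/-! ### The real projective plane and the cross-cap -/

/-- The unit sphere in Euclidean 3-space. -/
abbrev Sphere2 : Type := Metric.sphere (0 : EuclideanSpace ℝ (Fin 3)) 1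

/-- Identification of antipodal points of the sphere. -/
def antipodalSetoid : Setoid Sphere2 where
  r x y := x = y ∨ x = -y
  iseqv :=
    { refl := fun _ => Or.inl rfl
      symm := by
        rintro x y (rfl | rfl)
        · exact Or.inl rfl
        · exact Or.inr (neg_neg y).symm
      trans := by
        rintro x y z (rfl | rfl) (rfl | rfl)
        · exact Or.inl rfl
        · exact Or.inr rfl
        · exact Or.inr rfl
        · exact Or.inl (neg_neg z) }

/-- The real projective plane, with the quotient topology. -/
abbrev RP2 : Type := Quotient antipodalSetoid

/-- The quotient map from the sphere to the projective plane. -/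
def toRP2 : Sphere2 → RP2 := Quotient.mk antipodalSetoid

/-- An open disc in the projective plane, the image of a polar cap. -/
def polarDisc : Set RP2 := toRP2 '' {x : Sphere2 | 1 / 2 < x.1 2}

/-- The cross-cap: the projective plane with an open disc removed. -/
def crossCap : Set RP2 := polarDiscᶜ

/-- The boundary circle of the cross-cap. -/
def crossCapBoundary : Set RP2 := toRP2 '' {x : Sphere2 | x.1 2 = 1 / 2}

/-! ### Totally real blow-up -/

section BlowUp

variable {M : Type*} [TopologicalSpace M]

/-- `D` is an (injectively and continuously) embedded closed disc, with open disc `D₀`, so that its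
boundary circle is `D \ D₀`. -/
def IsClosedDisc (D D₀ : Set M) : Prop :=
  ∃ δ : ℂ → M, ContinuousOn δ (Metric.closedBall 0 1) ∧ InjOn δ (Metric.closedBall 0 1) ∧
    δ '' Metric.closedBall 0 1 = D ∧ δ '' Metric.ball 0 1 = D₀

/-- `C` is an (injectively and continuously) embedded cross-cap with boundary circle `B`. -/
def IsCrossCap (C B : Set M) : Prop :=
  ∃ κ : RP2 → M, ContinuousOn κ crossCap ∧ InjOn κ crossCap ∧
    κ '' crossCap = C ∧ κ '' crossCapBoundary = B

/-- `S'` is the connected sum `S # ℝP²` obtained inside `M` from `S` by removing the open disc `D₀`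
of a closed disc `D ⊆ S` and joining the cross-cap `C` to the rest along the circle `D \ D₀`. -/
structure IsCrossCapSum (S D D₀ C S' : Set M) : Prop where
  disc : IsClosedDisc D D₀
  disc_subset : D ⊆ S
  crossCap : IsCrossCap C (D \ D₀)
  inter : C ∩ (S \ D₀) = D \ D₀
  eq_union : S' = (S \ D₀) ∪ C

/-- `S'` is a totally real blow-up of `S` at `γ`, carried out inside `U`: an embedded real surface
which is a connected sum `S # ℝP²`, where the disc removed is a neighbourhood of `γ` without other
complex points, and the cross-cap joined is totally real. -/
structure IsTotallyRealBlowup [ChartedSpace (ℂ × ℂ) M] (S : Set M) (γ : M) (U S' : Set M) :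
    Prop where
  embedded : IsEmbeddedSurface S'
  sum : ∃ D D₀ C : Set M, IsCrossCapSum S D D₀ C S' ∧ γ ∈ D₀ ∧ D ⊆ U ∧ C ⊆ U ∧
    D ∩ complexPoints S ⊆ {γ} ∧ ∀ p ∈ C, IsTotallyRealAt S' p

end BlowUp

end TotallyRealBlowup

end

noncomputable section

namespace TotallyRealBlowup

open scoped ComplexConjugate

/-! ### Charts and their transition maps -/

section Charts

/-! The second assertion is local. The disc `D` and the cross-cap `C` are compact, so off `D ∪ C`
the new surface agrees with the old one near each point, and tangent planes, complex points and
indices depend only on the germ. On `C` the surface is totally real, so no complex point lies there.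
Thus exactly `γ`, of index `-1`, disappears (`IsTotallyRealBlowup.complexPoints_and_index`).

For existence, the surface is a graph `η = F(ξ)` in holomorphic coordinates. A graph is totally real
exactly where `∂F/∂ξ̄ ≠ 0`, and here `∂F/∂ξ̄` has winding number `-1` around `0`. The model with
this winding number is `η = ξ̄²`, with derivative `2ξ̄`.

The model has an explicit blow-up. On its graph, `ξ²η = |ξ|⁴` and `|η|²` are the same real number `y
≥ 0`. Replace the equation `|η|² = y` by `|η|² = Q(y)`, where `Q` is positive and `Q(y) = y` for `y
≥ δ`. Then `η` never vanishes, and in the local holomorphic coordinates `Z = ξ√η`, `W = log √η` the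
surface is `Im Z = 0`, `4 Re W = log Q(Z²)`: smooth and totally real. Going once around `η = 0`
changes the sign of `Z`, so the strip is a Möbius strip (`exists_flattening_modelCrossCap`,
`eq_zero_of_mem_velocities_modelCrossCap`, `exists_crossCap_parametrization`).

It remains to deform `F` into `ξ̄²` near `0` through a graph without new complex points. Equal
winding numbers give `∂F/∂ξ̄ = 2ξ̄ · exp l` on an annulus, hence a homotopy of nonvanishing
functions. One step of convex integration realizes it: a small, rapidly oscillating term is added to
a cut-off interpolation, so that the derivative runs through loops which avoid `0` although their
mean is prescribed (`exists_oscillation`, `meanLoop`, `exists_joining`). The oscillation is small in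
the sup norm, so everything stays inside the given neighbourhood. -/

theorem mem_contDiffGroupoid_self_iff {𝕜 E : Type*} [NontriviallyNormedField 𝕜]
    [NormedAddCommGroup E] [NormedSpace 𝕜 E] {n : ℕ∞ω} {f : OpenPartialHomeomorph E E} :
    f ∈ contDiffGroupoid n 𝓘(𝕜, E) ↔
      ContDiffOn 𝕜 n f f.source ∧ ContDiffOn 𝕜 n f.symm f.target := by
  rw [contDiffGroupoid, mem_groupoid_of_pregroupoid, contDiffPregroupoid]
  simp

theorem contDiffGroupoid_complex_le_real {E : Type*} [NormedAddCommGroup E] [NormedSpace ℂ E] :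
    contDiffGroupoid ω 𝓘(ℂ, E) ≤ contDiffGroupoid ∞ 𝓘(ℝ, E) := by
  intro f hf
  replace hf := mem_contDiffGroupoid_self_iff.1 hf
  refine mem_contDiffGroupoid_self_iff.2 ?_
  exact ⟨(hf.1.restrict_scalars ℝ).of_le le_top, (hf.2.restrict_scalars ℝ).of_le le_top⟩

theorem isManifold_real {E M : Type*} [NormedAddCommGroup E] [NormedSpace ℂ E]
    [TopologicalSpace M] [ChartedSpace E M] [IsManifold 𝓘(ℂ, E) ω M] :
    IsManifold 𝓘(ℝ, E) ∞ M := by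
  have : HasGroupoid M (contDiffGroupoid ∞ 𝓘(ℝ, E)) :=
    hasGroupoid_of_le (G₁ := contDiffGroupoid ω 𝓘(ℂ, E)) inferInstance
      contDiffGroupoid_complex_le_real
  exact IsManifold.mk' _ _ _

theorem maximalAtlas_complex_subset_real {E M : Type*} [NormedAddCommGroup E] [NormedSpace ℂ E]
    [TopologicalSpace M] [ChartedSpace E M] :
    IsManifold.maximalAtlas 𝓘(ℂ, E) ω M ⊆ IsManifold.maximalAtlas 𝓘(ℝ, E) ∞ M :=
  StructureGroupoid.maximalAtlas_mono contDiffGroupoid_complex_le_real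

variable {𝕜 E M : Type*} [NontriviallyNormedField 𝕜] [NormedAddCommGroup E] [NormedSpace 𝕜 E]
  [TopologicalSpace M] [ChartedSpace E M] {n : ℕ∞ω}

/-- Used over `ℂ` to centre a holomorphic chart, and over `ℝ` to turn a flattening of a model
surface in `ℂ²` into a flattening chart of `M`. -/
theorem trans_mem_maximalAtlas {e : OpenPartialHomeomorph M E}
    (he : e ∈ IsManifold.maximalAtlas 𝓘(𝕜, E) n M) {ψ : OpenPartialHomeomorph E E}
    (hψ : ψ ∈ contDiffGroupoid n 𝓘(𝕜, E)) :
    e.trans ψ ∈ IsManifold.maximalAtlas 𝓘(𝕜, E) n M := by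
  intro e' he'
  obtain ⟨h₁, h₂⟩ := he e' he'
  constructor
  · rw [OpenPartialHomeomorph.trans_symm_eq_symm_trans_symm, OpenPartialHomeomorph.trans_assoc]
    exact StructureGroupoid.trans _ (StructureGroupoid.symm _ hψ) h₁
  · rw [← OpenPartialHomeomorph.trans_assoc]
    exact StructureGroupoid.trans _ h₂ hψ

/-- The derivative of a transition map relates the velocities of a curve read in two charts. -/
theorem exists_transition_derivative [NormedSpace ℝ E] [NormedAlgebra ℝ 𝕜] [IsScalarTower ℝ 𝕜 E]
    (hn : n ≠ 0)
    {e e' : OpenPartialHomeomorph M E} (he : e ∈ IsManifold.maximalAtlas 𝓘(𝕜, E) n M)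
    (he' : e' ∈ IsManifold.maximalAtlas 𝓘(𝕜, E) n M) {p : M} (hp : p ∈ e.source)
    (hp' : p ∈ e'.source) :
    ∃ A : E ≃L[𝕜] E, ∀ c : ℝ → M, c 0 = p → ContinuousAt c 0 → ∀ v,
      (HasDerivAt (fun t => e (c t)) v 0 ↔ HasDerivAt (fun t => e' (c t)) (A v) 0) := by
  have key : ∀ {e e' : OpenPartialHomeomorph M E}, e ∈ IsManifold.maximalAtlas 𝓘(𝕜, E) n M →
      e' ∈ IsManifold.maximalAtlas 𝓘(𝕜, E) n M → p ∈ e.source → p ∈ e'.source →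
      ∃ A : E →L[𝕜] E, HasFDerivAt (e' ∘ e.symm) A (e p) := by
    intro e e' he he' hp hp'
    have h := (mem_contDiffGroupoid_self_iff.1
      (IsManifold.compatible_of_mem_maximalAtlas he he')).1
    have hmem : e p ∈ (e.symm.trans e').source := by
      simp [hp, hp']
    exact ⟨_, ((h.contDiffAt ((e.symm.trans e').open_source.mem_nhds hmem)).differentiableAt
      hn).hasFDerivAt⟩
  have push : ∀ {e e' : OpenPartialHomeomorph M E} {A : E →L[𝕜] E}, p ∈ e.source →
      HasFDerivAt (e' ∘ e.symm) A (e p) → ∀ c : ℝ → M, c 0 = p → ContinuousAt c 0 → ∀ v,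
      HasDerivAt (fun t => e (c t)) v 0 → HasDerivAt (fun t => e' (c t)) (A v) 0 := by
    intro e e' A hp hA c hc0 hc v hv
    have hA' : HasFDerivAt (e' ∘ e.symm) (A.restrictScalars ℝ) (e (c 0)) := by
      rw [hc0]; exact hA.restrictScalars ℝ
    refine (hA'.comp_hasDerivAt (0 : ℝ) hv).congr_of_eventuallyEq ?_
    filter_upwards [hc.preimage_mem_nhds (e.open_source.mem_nhds (hc0 ▸ hp))] with t ht
    simp [e.left_inv ht]
  have inverse : ∀ {e e' : OpenPartialHomeomorph M E} {A B : E →L[𝕜] E}, p ∈ e.source →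
      p ∈ e'.source → HasFDerivAt (e' ∘ e.symm) A (e p) → HasFDerivAt (e ∘ e'.symm) B (e' p) →
      ∀ x, B (A x) = x := by
    intro e e' A B hp hp' hA hB x
    have hB' : HasFDerivAt (e ∘ e'.symm) B ((e' ∘ e.symm) (e p)) := by simpa [hp] using hB
    have h : HasFDerivAt (fun y => y) (B.comp A) (e p) := by
      refine (hB'.comp (e p) hA).congr_of_eventuallyEq ?_
      have hmem : e p ∈ (e.symm.trans e').source := by simp [hp, hp']
      filter_upwards [(e.symm.trans e').open_source.mem_nhds hmem] with y hy
      simp only [OpenPartialHomeomorph.trans_source, OpenPartialHomeomorph.symm_source,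
        mem_inter_iff, mem_preimage] at hy
      simp [e'.left_inv hy.2, e.right_inv hy.1]
    exact congr($(h.unique (hasFDerivAt_id (e p))) x)
  obtain ⟨A, hA⟩ := key he he' hp hp'
  obtain ⟨B, hB⟩ := key he' he hp' hp
  have hBA := inverse hp hp' hA hB
  have hAB := inverse hp' hp hB hA
  refine ⟨ContinuousLinearEquiv.equivOfInverse A B hBA hAB, fun c hc0 hc v => ⟨fun h => ?_,
    fun h => ?_⟩⟩
  · exact push hp hA c hc0 hc v h
  · have := push hp' hB c hc0 hc _ h
    simpa [hBA] using this

end Charts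

/-! ### Tangent planes -/

section TangentPlanes

variable {M : Type*} [TopologicalSpace M] [ChartedSpace (ℂ × ℂ) M] {S S' : Set M} {p : M}

theorem tangentPlane_congr (h : ∀ᶠ x in 𝓝 p, x ∈ S' ↔ x ∈ S) :
    tangentPlane S' p = tangentPlane S p := by
  have key : ∀ {S S' : Set M}, (∀ᶠ x in 𝓝 p, x ∈ S' ↔ x ∈ S) →
      tangentPlane S' p ⊆ tangentPlane S p := by
    rintro S S' h v ⟨c, hc0, hc, hcS, hv⟩
    refine ⟨c, hc0, hc, ?_, hv⟩
    have h' : ∀ᶠ t in 𝓝 (0 : ℝ), c t ∈ S' ↔ c t ∈ S := hc.eventually (by rwa [hc0])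
    filter_upwards [hcS, h'] with t ht ht'
    exact ht'.1 ht
  exact Subset.antisymm (key h) (key (h.mono fun _ hx => hx.symm))

variable [IsManifold 𝓘(ℂ, ℂ × ℂ) ω M]

/-- The derivative of the transition to a flattening chart carries velocities to velocities, and in
that chart straight lines realize every vector of `ℂ × {0}`. So the set of velocities is a real
2-dimensional subspace. -/
theorem IsEmbeddedSurface.exists_tangentPlane_eq (hS : IsEmbeddedSurface S) (hp : p ∈ S) :
    ∃ B : (ℂ × ℂ) ≃L[ℝ] (ℂ × ℂ), tangentPlane S p = {v | (B v).2 = 0} := by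
  have := isManifold_real (E := ℂ × ℂ) (M := M)
  obtain ⟨φ, hφ, hpφ, hφS⟩ := hS p hp
  obtain ⟨B, hB⟩ := exists_transition_derivative (𝕜 := ℝ) (by simp)
    (IsManifold.chart_mem_maximalAtlas (I := 𝓘(ℝ, ℂ × ℂ)) (n := ∞) p) hφ
    (mem_chart_source (ℂ × ℂ) p) hpφ
  refine ⟨B, Subset.antisymm ?_ ?_⟩
  · rintro v ⟨c, hc0, hc, hcS, hv⟩
    have h : HasDerivAt (fun t => (φ (c t)).2) (B v).2 0 :=
      (hasFDerivAt_snd (𝕜 := ℝ) (E := ℂ) (F := ℂ)).comp_hasDerivAt (0 : ℝ)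
        ((hB c hc0 hc v).1 hv)
    refine h.unique ((hasDerivAt_const (0 : ℝ) (0 : ℂ)).congr_of_eventuallyEq ?_)
    filter_upwards [hcS, hc.preimage_mem_nhds (φ.open_source.mem_nhds (hc0 ▸ hpφ))] with t ht ht'
    exact (hφS _ ht').1 ht
  · intro v hv
    have hline : HasDerivAt (fun t : ℝ => φ p + t • B v) (B v) 0 := by
      simpa using ((hasDerivAt_id (0 : ℝ)).smul_const (B v)).const_add (φ p)
    have htgt : ∀ᶠ t : ℝ in 𝓝 0, φ p + t • B v ∈ φ.target := by
      refine hline.continuousAt.preimage_mem_nhds (φ.open_target.mem_nhds ?_)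
      simpa using φ.map_source hpφ
    have hc0 : φ.symm (φ p + (0 : ℝ) • B v) = p := by simp [hpφ]
    have hc : ContinuousAt (fun t : ℝ => φ.symm (φ p + t • B v)) 0 := by
      refine ContinuousAt.comp (g := φ.symm) ?_ hline.continuousAt
      exact φ.symm.continuousAt (by simpa using φ.map_source hpφ)
    refine ⟨_, hc0, hc, ?_, (hB _ hc0 hc v).2 (hline.congr_of_eventuallyEq ?_)⟩
    · filter_upwards [htgt] with t ht
      rw [hφS _ (φ.map_target ht), φ.right_inv ht]
      have : (φ p).2 = 0 := (hφS p hpφ).1 hp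
      simp [this, show (B v).2 = 0 from hv]
    · filter_upwards [htgt] with t ht
      exact φ.right_inv ht

theorem IsEmbeddedSurface.not_isTotallyRealAt_of_mem_complexPoints (hS : IsEmbeddedSurface S)
    (hp : p ∈ complexPoints S) : ¬ IsTotallyRealAt S p := by
  intro h
  obtain ⟨B, hB⟩ := hS.exists_tangentPlane_eq hp.1
  have hv : B.symm (1, 0) ∈ tangentPlane S p := by simp [hB]
  have h0 := h _ hv (hp.2 _ hv)
  simp at h0

/-- If `v ≠ 0` and `iv` are both tangent, they form a real basis of the 2-dimensional tangent plane,
which is then the complex line `ℂ v`. -/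
theorem IsEmbeddedSurface.isTotallyRealAt_of_notMem_complexPoints (hS : IsEmbeddedSurface S)
    (hp : p ∈ S) (hpc : p ∉ complexPoints S) : IsTotallyRealAt S p := by
  obtain ⟨B, hB⟩ := hS.exists_tangentPlane_eq hp
  intro v hv hiv
  by_contra hv0
  refine hpc ⟨hp, fun w hw => ?_⟩
  rw [hB, mem_ofPred_eq] at hv hiv hw ⊢
  set a := (B v).1 with ha
  set b := (B (Complex.I • v)).1 with hb
  set c := (B w).1 with hc
  have hcomb : ∀ x y : ℝ, B ((x + y * Complex.I : ℂ) • v) = (x * a + y * b, 0) := by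
    intro x y
    have : (x + y * Complex.I : ℂ) • v = x • v + y • (Complex.I • v) := by
      rw [add_smul, mul_smul]; rfl
    rw [this, map_add, map_smul, map_smul]
    ext1 <;> simp [hv, hiv, ha, hb]
  have hinj : ∀ x y : ℝ, (x * a + y * b : ℂ) = 0 → x = 0 ∧ y = 0 := by
    intro x y hxy
    have h := hcomb x y
    rw [hxy, Prod.mk_zero_zero, map_eq_zero_iff B B.injective, smul_eq_zero] at h
    have h' := h.resolve_right hv0
    exact ⟨by simpa using congrArg Complex.re h', by simpa using congrArg Complex.im h'⟩
  -- If this determinant vanished, `b.re * a - a.re * b` and `b.im * a - a.im * b` would be zero.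
  -- Independence of `a` and `b` would then force `a = 0`, which independence excludes.
  have hD : a.re * b.im - a.im * b.re ≠ 0 := by
    intro hD
    have h1 := hinj b.re (-a.re) (by
      apply Complex.ext
      · simp; ring
      · simp; linarith)
    have h2 := hinj b.im (-a.im) (by
      apply Complex.ext
      · simp; linarith
      · simp; ring)
    have ha0 : a = 0 := Complex.ext (by simpa using h1.2) (by simpa using h2.2)
    simpa using (hinj 1 0 (by simp [ha0])).1
  obtain ⟨x, y, hxy⟩ : ∃ x y : ℝ, (x * a + y * b : ℂ) = c := by
    suffices h : ∃ x y : ℝ, x * a.re + y * b.re = c.re ∧ x * a.im + y * b.im = c.im by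
      obtain ⟨x, y, h₁, h₂⟩ := h
      exact ⟨x, y, Complex.ext (by simpa using h₁) (by simpa using h₂)⟩
    refine ⟨(c.re * b.im - c.im * b.re) / (a.re * b.im - a.im * b.re),
      (a.re * c.im - a.im * c.re) / (a.re * b.im - a.im * b.re), ?_, ?_⟩
    all_goals
      rw [div_mul_eq_mul_div, div_mul_eq_mul_div, ← add_div, div_eq_iff hD]
      ring
  have hw' : w = (x + y * Complex.I : ℂ) • v := by
    apply B.injective
    rw [hcomb, hxy]
    exact Prod.ext rfl hw
  have : Complex.I • w = (((-y : ℝ) : ℂ) + x * Complex.I : ℂ) • v := by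
    rw [hw', smul_smul]
    congr 1
    push_cast
    ring_nf
    simp
    ring
  rw [this, hcomb]

end TangentPlanes

/-! ### Complex points and indices of a blow-up -/

section Outside

variable {M : Type*} [TopologicalSpace M]

theorem isOpen_polarDisc : IsOpen polarDisc := by
  have hz : Continuous fun x : Sphere2 => x.1 2 := by fun_prop
  have hq : Topology.IsQuotientMap toRP2 := isQuotientMap_quotient_mk'
  rw [polarDisc, ← hq.isOpen_preimage]
  have : toRP2 ⁻¹' (toRP2 '' {x : Sphere2 | 1 / 2 < x.1 2}) =
      {x : Sphere2 | 1 / 2 < x.1 2} ∪ {x : Sphere2 | x.1 2 < -(1 / 2)} := by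
    ext x
    constructor
    · rintro ⟨y, hy, hxy⟩
      rcases Quotient.exact hxy with rfl | rfl
      · exact Or.inl hy
      · right
        have : 1 / 2 < -(x.1 2) := hy
        show x.1 2 < -(1 / 2)
        linarith
    · rintro (hx | hx)
      · exact ⟨x, hx, rfl⟩
      · refine ⟨-x, ?_, Quotient.sound (Or.inr rfl)⟩
        have : x.1 2 < -(1 / 2) := hx
        show 1 / 2 < -(x.1 2)
        linarith
  rw [this]
  exact (isOpen_lt continuous_const hz).union (isOpen_lt hz continuous_const)

theorem isCompact_crossCap : IsCompact crossCap := by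
  have : CompactSpace Sphere2 := Metric.sphere.compactSpace _ _
  exact isOpen_polarDisc.isClosed_compl.isCompact

theorem IsClosedDisc.isCompact {D D₀ : Set M} (h : IsClosedDisc D D₀) : IsCompact D := by
  obtain ⟨δ, hδ, -, rfl, -⟩ := h
  exact (isCompact_closedBall _ _).image_of_continuousOn hδ

theorem IsCrossCap.isCompact {C B : Set M} (h : IsCrossCap C B) : IsCompact C := by
  obtain ⟨κ, hκ, -, rfl, -⟩ := h
  exact isCompact_crossCap.image_of_continuousOn hκ

theorem IsCrossCap.boundary_subset {C B : Set M} (h : IsCrossCap C B) : B ⊆ C := by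
  obtain ⟨κ, -, -, rfl, rfl⟩ := h
  refine image_mono ?_
  rintro _ ⟨x, hx, rfl⟩ ⟨y, hy, hxy⟩
  have hx' : x.1 2 = 1 / 2 := hx
  have hy' : 1 / 2 < y.1 2 := hy
  rcases Quotient.exact hxy with rfl | rfl
  · linarith
  · have : -(x.1 2) = (-x).1 2 := rfl
    rw [← this] at hy'
    linarith

variable {S D D₀ C S' : Set M} {p : M}

theorem IsCrossCapSum.notMem_of_notMem (h : IsCrossCapSum S D D₀ C S') (hp : p ∈ S)
    (hpD : p ∉ D) : p ∉ C := by
  intro hpC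
  have hD₀ : D₀ ⊆ D := by
    obtain ⟨δ, -, -, rfl, rfl⟩ := h.disc
    exact image_mono Metric.ball_subset_closedBall
  have : p ∈ D \ D₀ := h.inter ▸ ⟨hpC, hp, fun h' => hpD (hD₀ h')⟩
  exact hpD this.1

/-- A point of the connected sum outside the cross-cap is a point of the original surface outside
the disc. -/
theorem IsCrossCapSum.mem_and_notMem_of_notMem_crossCap (h : IsCrossCapSum S D D₀ C S')
    (hp : p ∈ S') (hpC : p ∉ C) : p ∈ S ∧ p ∉ D := by
  rw [h.eq_union] at hp
  have hp' := hp.resolve_right hpC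
  exact ⟨hp'.1, fun hpD => hpC (h.crossCap.boundary_subset ⟨hpD, hp'.2⟩)⟩

section

variable [ChartedSpace (ℂ × ℂ) M]

/-- The two predicates `HasComplexIndex` coincide, so the same integer is chosen from them.
Independence of the index from the coordinates is not needed. -/
theorem complexIndex_congr (h : ∀ᶠ x in 𝓝 p, x ∈ S' ↔ x ∈ S) :
    complexIndex S' p = complexIndex S p := by
  have : HasComplexIndex S' p = HasComplexIndex S p := by
    ext k
    refine exists_congr fun φ => and_congr_right fun _ => exists_congr fun F =>
      and_congr_right fun _ => and_congr_right fun _ => and_congr_left fun _ => ?_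
    refine eventually_congr ?_
    filter_upwards [h] with x hx
    rw [hx]
  unfold complexIndex
  rw [this]

theorem mem_complexPoints_congr (h : ∀ᶠ x in 𝓝 p, x ∈ S' ↔ x ∈ S) :
    p ∈ complexPoints S' ↔ p ∈ complexPoints S := by
  simp only [complexPoints, mem_ofPred_eq, tangentPlane_congr h, h.self_of_nhds]

end

variable [T2Space M]

/-- Away from the disc and the cross-cap, the connected sum is the original surface. -/
theorem eventually_mem_iff_of_notMem (hD : IsCompact D) (hD₀ : D₀ ⊆ D) (hC : IsCompact C)
    (hS' : S' = (S \ D₀) ∪ C) (hpD : p ∉ D) (hpC : p ∉ C) : ∀ᶠ x in 𝓝 p, x ∈ S' ↔ x ∈ S := by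
  filter_upwards [hD.isClosed.isOpen_compl.mem_nhds hpD, hC.isClosed.isOpen_compl.mem_nhds hpC]
    with x hxD hxC
  have : x ∉ D₀ := fun h => hxD (hD₀ h)
  simp only [mem_compl_iff] at hxC
  simp [hS', this, hxC]

theorem IsCrossCapSum.eventually_mem_iff (h : IsCrossCapSum S D D₀ C S') (hpD : p ∉ D)
    (hpC : p ∉ C) : ∀ᶠ x in 𝓝 p, x ∈ S' ↔ x ∈ S := by
  refine eventually_mem_iff_of_notMem h.disc.isCompact ?_ h.crossCap.isCompact h.eq_union hpD hpC
  obtain ⟨δ, -, -, rfl, rfl⟩ := h.disc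
  exact image_mono Metric.ball_subset_closedBall

variable [ChartedSpace (ℂ × ℂ) M] [IsManifold 𝓘(ℂ, ℂ × ℂ) ω M] {γ : M} {U : Set M}

/-- A complex point of `S'` cannot lie on the totally real `C`, hence not on `D` either. A complex
point of `S` other than `γ` lies off `D`, hence off `C`. At all such points the two surfaces have
the same germ. -/
theorem IsTotallyRealBlowup.complexPoints_and_index (h : IsTotallyRealBlowup S γ U S') :
    complexPoints S' = complexPoints S \ {γ} ∧
      ∀ p ∈ complexPoints S', complexIndex S' p = complexIndex S p := by
  obtain ⟨hemb, D, D₀, C, hsum, hγ, -, -, hDγ, hC⟩ := h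
  have out : ∀ p ∈ complexPoints S', p ∈ S ∧ p ∉ D ∧ p ∉ C := by
    intro p hp
    have hpC : p ∉ C := fun hpC =>
      hemb.not_isTotallyRealAt_of_mem_complexPoints hp (hC p hpC)
    have := hsum.mem_and_notMem_of_notMem_crossCap hp.1 hpC
    exact ⟨this.1, this.2, hpC⟩
  have hγD : γ ∈ D := by
    obtain ⟨δ, -, -, rfl, rfl⟩ := hsum.disc
    exact image_mono Metric.ball_subset_closedBall hγ
  refine ⟨Subset.antisymm ?_ ?_, ?_⟩
  · intro p hp
    obtain ⟨-, hpD, hpC⟩ := out p hp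
    exact ⟨(mem_complexPoints_congr (hsum.eventually_mem_iff hpD hpC)).1 hp,
      fun hpγ => hpD (hpγ ▸ hγD)⟩
  · rintro p ⟨hp, hpγ⟩
    have hpD : p ∉ D := fun hpD => hpγ (hDγ ⟨hpD, hp⟩)
    have hpC := hsum.notMem_of_notMem hp.1 hpD
    exact (mem_complexPoints_congr (hsum.eventually_mem_iff hpD hpC)).2 hp
  · intro p hp
    obtain ⟨-, hpD, hpC⟩ := out p hp
    exact complexIndex_congr (hsum.eventually_mem_iff hpD hpC)

theorem IsTotallyRealBlowup.complexIndexSum_eq (h : IsTotallyRealBlowup S γ U S')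
    (hγ : IsHyperbolicPoint S γ) (hfin : (complexPoints S).Finite) :
    complexIndexSum S' = complexIndexSum S + 1 := by
  obtain ⟨hpts, hind⟩ := h.complexPoints_and_index
  have h1 : complexIndexSum S' = ∑ᶠ p ∈ complexPoints S \ {γ}, complexIndex S p := by
    rw [complexIndexSum, ← hpts]
    exact finsum_mem_congr rfl hind
  -- Finiteness matters here: a `∑ᶠ` with infinite support has the default value `0`, and no term
  -- could be split off.
  have h2 : complexIndexSum S = complexIndex S γ +
      ∑ᶠ p ∈ complexPoints S \ {γ}, complexIndex S p := by
    rw [complexIndexSum, ← finsum_mem_insert (complexIndex S) (by simp) (hfin.subset sdiff_subset),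
      insert_sdiff_self_of_mem hγ.1]
  rw [h1, h2, hγ.2.2]
  ring

theorem IsTotallyRealBlowup.isTotallyReal (h : IsTotallyRealBlowup S γ U S')
    (hγ : complexPoints S = {γ}) : IsTotallyReal S' := by
  intro p hp
  refine h.embedded.isTotallyRealAt_of_notMem_complexPoints hp ?_
  simp [h.complexPoints_and_index.1, hγ]

end Outside

/-! ### The operator `∂/∂ξ̄` -/

section Dbar

variable {F G : ℂ → ℂ} {z : ℂ}

theorem dbar_of_hasFDerivAt {L : ℂ →L[ℝ] ℂ} (h : HasFDerivAt F L z) :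
    dbar F z = (L 1 + Complex.I * L Complex.I) / 2 := by
  rw [dbar, h.fderiv]

theorem dbar_congr (h : F =ᶠ[𝓝 z] G) : dbar F z = dbar G z := by
  rw [dbar, dbar, h.fderiv_eq]

theorem dbar_add (hF : DifferentiableAt ℝ F z) (hG : DifferentiableAt ℝ G z) :
    dbar (fun ξ => F ξ + G ξ) z = dbar F z + dbar G z := by
  have h : HasFDerivAt (fun ξ => F ξ + G ξ) _ z := hF.hasFDerivAt.add hG.hasFDerivAt
  rw [dbar_of_hasFDerivAt h, dbar, dbar]
  simp only [add_apply]
  ring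

theorem dbar_mul (hF : DifferentiableAt ℝ F z) (hG : DifferentiableAt ℝ G z) :
    dbar (fun ξ => F ξ * G ξ) z = F z * dbar G z + dbar F z * G z := by
  have h : HasFDerivAt (fun ξ => F ξ * G ξ) _ z := hF.hasFDerivAt.mul hG.hasFDerivAt
  rw [dbar_of_hasFDerivAt h, dbar, dbar]
  simp only [add_apply, smul_apply, smul_eq_mul]
  ring

theorem dbar_conj_sq : dbar (fun ξ => conj ξ ^ 2) z = 2 * conj z := by
  have h : HasFDerivAt (fun ξ : ℂ => conj ξ * conj ξ) _ z :=
    (Complex.conjCLE.toContinuousLinearMap.hasFDerivAt (x := z)).mul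
      (Complex.conjCLE.toContinuousLinearMap.hasFDerivAt (x := z))
  simp only [pow_two]
  rw [dbar_of_hasFDerivAt h]
  simp
  linear_combination (-conj z) * Complex.I_sq

/-- The operator `∂/∂ξ̄` on the oscillating functions `exp (c Re ξ)`. -/
theorem dbar_exp_re (c : ℂ) :
    dbar (fun ξ => Complex.exp (c * ξ.re)) z = c / 2 * Complex.exp (c * z.re) := by
  have h : HasFDerivAt (fun ξ : ℂ => Complex.exp (c * (Complex.ofRealCLM.comp Complex.reCLM) ξ))
      _ z := (((Complex.ofRealCLM.comp Complex.reCLM).hasFDerivAt (x := z)).const_mul c).cexp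
  rw [dbar_of_hasFDerivAt (F := fun ξ => Complex.exp (c * ξ.re)) h]
  simp
  ring

theorem contDiff_dbar (hF : ContDiff ℝ ∞ F) : ContDiff ℝ ∞ (dbar F) := by
  have h : ContDiff ℝ ∞ (fderiv ℝ F) := hF.fderiv_right (by simp)
  unfold dbar
  exact ((h.clm_apply contDiff_const).add
    (contDiff_const.mul (h.clm_apply contDiff_const))).div_const 2

theorem contDiff_conj : ContDiff ℝ ∞ (fun ξ : ℂ => conj ξ) :=
  Complex.conjCLE.contDiff

end Dbar

/-! ### Radial cut-off functions -/

section Cutoff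

/-- A smooth radial function on the plane which is `0` for `‖ξ‖ ≤ a` and `1` for `b ≤ ‖ξ‖`. -/
def radialCut (a b : ℝ) (ξ : ℂ) : ℝ :=
  -- The squared norm is used because the norm is not smooth at `0`.
  Real.smoothTransition ((‖ξ‖ ^ 2 - a ^ 2) / (b ^ 2 - a ^ 2))

variable {a b : ℝ} {ξ : ℂ}

theorem contDiff_radialCut : ContDiff ℝ ∞ (radialCut a b) :=
  Real.smoothTransition.contDiff.comp (((contDiff_norm_sq ℝ).sub contDiff_const).div_const _)

theorem radialCut_eq_zero (ha : 0 ≤ a) (hab : a < b) (h : ‖ξ‖ ≤ a) : radialCut a b ξ = 0 := by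
  refine Real.smoothTransition.zero_of_nonpos (div_nonpos_of_nonpos_of_nonneg ?_ ?_)
  · have := pow_le_pow_left₀ (norm_nonneg ξ) h 2
    linarith
  · have := pow_le_pow_left₀ ha hab.le 2
    linarith

theorem radialCut_eq_one (ha : 0 ≤ a) (hab : a < b) (h : b ≤ ‖ξ‖) : radialCut a b ξ = 1 := by
  refine Real.smoothTransition.one_of_one_le ?_
  rw [one_le_div (by have := pow_lt_pow_left₀ hab ha two_ne_zero; linarith)]
  have := pow_le_pow_left₀ (ha.trans hab.le) h 2
  linarith

theorem radialCut_mem_Icc : radialCut a b ξ ∈ Icc (0 : ℝ) 1 :=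
  ⟨Real.smoothTransition.nonneg _, Real.smoothTransition.le_one _⟩

/-- A smooth function on the plane which is `1` on the closed annulus between the radii `b` and `c`,
and `0` outside the annulus between `a` and `d`. -/
def annularBump (a b c d : ℝ) (ξ : ℂ) : ℝ :=
  radialCut a b ξ * (1 - radialCut c d ξ)

variable {c d : ℝ}

theorem contDiff_annularBump : ContDiff ℝ ∞ (annularBump a b c d) :=
  contDiff_radialCut.mul (contDiff_const.sub contDiff_radialCut)

theorem annularBump_eq_zero (ha : 0 ≤ a) (hab : a < b) (hbc : b ≤ c) (hcd : c < d)
    (h : ‖ξ‖ ≤ a ∨ d ≤ ‖ξ‖) : annularBump a b c d ξ = 0 := by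
  rcases h with h | h
  · simp [annularBump, radialCut_eq_zero ha hab h]
  · simp [annularBump, radialCut_eq_one ((ha.trans hab.le).trans hbc) hcd h]

theorem annularBump_eq_one (ha : 0 ≤ a) (hab : a < b) (hbc : b ≤ c) (hcd : c < d)
    (h : b ≤ ‖ξ‖) (h' : ‖ξ‖ ≤ c) : annularBump a b c d ξ = 1 := by
  simp [annularBump, radialCut_eq_one ha hab h,
    radialCut_eq_zero ((ha.trans hab.le).trans hbc) hcd h']

theorem annularBump_mem_Icc : annularBump a b c d ξ ∈ Icc (0 : ℝ) 1 := by
  have h1 := radialCut_mem_Icc (a := a) (b := b) (ξ := ξ)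
  have h2 := radialCut_mem_Icc (a := c) (b := d) (ξ := ξ)
  refine ⟨mul_nonneg h1.1 (by linarith [h2.2]), mul_le_one₀ h1.2 (by linarith [h2.2])
    (by linarith [h2.1])⟩

end Cutoff

/-! ### Smooth logarithms -/

section Logarithm

/-- A continuous logarithm of a smooth function is smooth. -/
theorem contDiffAt_of_exp_eq {E : Type*} [NormedAddCommGroup E] [NormedSpace ℝ E] {g l : E → ℂ}
    {x : E} (hl : ContinuousAt l x) (hg : ContDiffAt ℝ ∞ g x)
    (h : ∀ᶠ y in 𝓝 x, g y = Complex.exp (l y)) : ContDiffAt ℝ ∞ l x := by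
  have hx := h.self_of_nhds
  have hgx : g x ≠ 0 := by rw [hx]; exact Complex.exp_ne_zero _
  -- Near `x` the function `l` must equal this smooth one: by continuity the imaginary part of `l y
  -- - l x` stays in `(-π, π)`, where the principal logarithm inverts `exp`.
  have hlog : ContDiffAt ℝ ∞ (fun y => Complex.log (g y / g x) + l x) x := by
    refine ContDiffAt.add ?_ contDiffAt_const
    refine ContDiffAt.comp (g := Complex.log) x ?_ (hg.div_const _)
    refine (Complex.contDiffAt_log (n := ∞) ?_).restrict_scalars ℝ
    simp [div_self hgx]
  refine hlog.congr_of_eventuallyEq ?_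
  have him : ∀ᶠ y in 𝓝 x, |(l y - l x).im| < Real.pi := by
    have hc : ContinuousAt (fun y => |(l y - l x).im|) x :=
      (Complex.continuous_im.continuousAt.comp (hl.sub continuousAt_const)).abs
    refine hc.eventually_lt continuousAt_const ?_
    simpa using Real.pi_pos
  filter_upwards [h, him] with y hy hyim
  rw [abs_lt] at hyim
  rw [hy, hx, ← Complex.exp_sub, Complex.log_exp hyim.1 hyim.2.le]
  ring

/-- A nonvanishing function whose winding number along a circle is zero has a smooth logarithm on an
annulus. -/
theorem exists_log_on_annulus {g : ℂ → ℂ} {r R : ℝ} (hr : 0 < r) (hrR : r < R)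
    (hg : ∀ ξ, ξ ≠ 0 → ‖ξ‖ < R → ContDiffAt ℝ ∞ g ξ)
    (hw : HasWindingNumber (fun t => g (r * Complex.exp (t * Complex.I))) 0) :
    ∃ r₁ r₂ : ℝ, 0 < r₁ ∧ r₁ < r₂ ∧ r₂ < R ∧ ∃ l : ℂ → ℂ, ContDiff ℝ ∞ l ∧
      ∀ ξ, r₁ ≤ ‖ξ‖ → ‖ξ‖ ≤ r₂ → g ξ = Complex.exp (l ξ) := by
  obtain ⟨l, hlc, hl, hl0⟩ := hw
  have hper : l 0 = l (2 * Real.pi) := by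
    rw [Int.cast_zero, mul_zero, sub_eq_zero] at hl0
    exact hl0.symm
  have := Fact.mk Real.two_pi_pos
  -- Winding number zero makes `l` periodic, so it descends to the circle.
  let L : Real.Angle → ℂ := AddCircle.liftIco (2 * Real.pi) 0 l
  have hLc : Continuous L := AddCircle.liftIco_zero_continuous hper hlc
  have hL : ∀ θ : ℝ, Complex.exp (L θ) = g (r * Complex.exp (θ * Complex.I)) := by
    intro θ
    obtain ⟨t, ht, hθ⟩ : ∃ t ∈ Ico 0 (2 * Real.pi), (t : Real.Angle) = θ := by
      have := AddCircle.coe_image_Ico_eq (2 * Real.pi) 0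
      rw [zero_add] at this
      exact (this ▸ mem_univ (θ : AddCircle (2 * Real.pi)) :)
    have hexp : Complex.exp (θ * Complex.I) = Complex.exp (t * Complex.I) := by
      rw [← Circle.coe_exp, ← Circle.coe_exp, ← Real.Angle.toCircle_coe,
        ← Real.Angle.toCircle_coe, hθ]
    rw [← hθ, hexp]
    exact (congrArg Complex.exp (AddCircle.liftIco_zero_coe_apply ht)).trans
      (hl t ⟨ht.1, ht.2.le⟩).symm
  have hLarg : ∀ ξ : ℂ, ξ ≠ 0 → Complex.exp (L ξ.arg) = g (r * (ξ / ‖ξ‖)) := by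
    intro ξ hξ
    rw [hL]
    congr 2
    rw [eq_div_iff (by simpa using hξ), mul_comm]
    exact Complex.norm_mul_exp_arg_mul_I ξ
  have hproj : ∀ ξ : ℂ, ξ ≠ 0 → ‖(r * (ξ / ‖ξ‖) : ℂ)‖ = r := by
    intro ξ hξ
    simp [hξ, abs_of_pos hr]
  -- This radial quotient is `1` on the circle of radius `r`. By compactness it takes values in the
  -- slit plane on a thin annulus, where its principal logarithm extends `L` off the circle.
  let Φ : ℂ → ℂ := fun ξ => g ξ / g (r * (ξ / ‖ξ‖))
  have hΦc : ∀ ξ, ξ ≠ 0 → ‖ξ‖ < R → ContinuousAt Φ ξ := by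
    intro ξ hξ hξR
    have h0 : (r * (ξ / ‖ξ‖) : ℂ) ≠ 0 := by
      rw [← norm_ne_zero_iff, hproj ξ hξ]; exact hr.ne'
    have h1 : ContinuousAt (fun ξ : ℂ => (r * (ξ / ‖ξ‖) : ℂ)) ξ :=
      continuousAt_const.mul (continuousAt_id.div
        (Complex.continuous_ofReal.comp continuous_norm).continuousAt (by simpa using hξ))
    refine (hg ξ hξ hξR).continuousAt.div (ContinuousAt.comp (g := g) ?_ h1) ?_
    · exact (hg _ h0 (by rw [hproj ξ hξ]; exact hrR)).continuousAt
    · rw [← hLarg ξ hξ]; exact Complex.exp_ne_zero _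
  have hnhd : {ξ : ℂ | ξ ≠ 0 ∧ ‖ξ‖ < R ∧ Φ ξ ∈ Complex.slitPlane} ∈
      𝓝ˢ (Metric.sphere (0 : ℂ) r) := by
    rw [mem_nhdsSet_iff_forall]
    intro ξ hξ
    have hξr : ‖ξ‖ = r := by simpa using hξ
    have hξ0 : ξ ≠ 0 := by rw [← norm_ne_zero_iff, hξr]; exact hr.ne'
    have hΦ1 : Φ ξ = 1 := by
      have : (r * (ξ / ‖ξ‖) : ℂ) = ξ := by
        have : (r : ℂ) ≠ 0 := by exact_mod_cast hr.ne'
        rw [hξr]; field_simp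
      simp only [Φ, this]
      refine div_self ?_
      rw [← this, ← hLarg ξ hξ0]; exact Complex.exp_ne_zero _
    filter_upwards [isOpen_ne.mem_nhds hξ0,
      continuous_norm.continuousAt.eventually_lt continuousAt_const (hξr.trans_lt hrR),
      (hΦc ξ hξ0 (hξr.trans_lt hrR)).preimage_mem_nhds
        (Complex.isOpen_slitPlane.mem_nhds (by rw [hΦ1]; simp))] with y h1 h2 h3
    exact ⟨h1, h2, h3⟩
  obtain ⟨δ, hδ, hδsub⟩ := (isCompact_sphere (0 : ℂ) r).exists_thickening_subset_open
    isOpen_interior (subset_interior_iff_mem_nhdsSet.2 hnhd)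
  have hann : ∀ ξ : ℂ, |‖ξ‖ - r| < min δ r → ξ ≠ 0 ∧ ‖ξ‖ < R ∧ Φ ξ ∈ Complex.slitPlane := by
    intro ξ hξ
    have hξ0 : ξ ≠ 0 := by
      rintro rfl
      have := hξ.trans_le (min_le_right _ _)
      simp [abs_of_pos hr] at this
    refine interior_subset (s := {ξ : ℂ | ξ ≠ 0 ∧ ‖ξ‖ < R ∧ Φ ξ ∈ Complex.slitPlane}) (hδsub (Metric.mem_thickening_iff.2 ⟨r * (ξ / ‖ξ‖), ?_, ?_⟩))
    · simp [hξ0, abs_of_pos hr]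
    · have h1 : ξ - r * (ξ / ‖ξ‖) = ((‖ξ‖ - r : ℝ) : ℂ) * (ξ / ‖ξ‖) := by
        have : (‖ξ‖ : ℂ) ≠ 0 := by simpa using hξ0
        push_cast
        field_simp
      rw [dist_eq_norm, h1, norm_mul, Complex.norm_real, norm_div, Complex.norm_real, norm_norm,
        div_self (by simpa using hξ0), mul_one]
      exact hξ.trans_le (min_le_left _ _)
  set m := min δ r with hm
  have hm0 : 0 < m := lt_min hδ hr
  have hmr : m ≤ r := min_le_right _ _
  let lg : ℂ → ℂ := fun ξ => L ξ.arg + Complex.log (Φ ξ)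
  have hlg : ∀ ξ : ℂ, |‖ξ‖ - r| < m → g ξ = Complex.exp (lg ξ) := by
    intro ξ hξ
    obtain ⟨h0, -, hs⟩ := hann ξ hξ
    have hne : g (r * (ξ / ‖ξ‖)) ≠ 0 := by rw [← hLarg ξ h0]; exact Complex.exp_ne_zero _
    simp only [lg]
    rw [Complex.exp_add, Complex.exp_log (Complex.slitPlane_ne_zero hs), hLarg ξ h0]
    simp only [Φ]
    rw [mul_div_cancel₀ _ hne]
  have hlgs : ∀ ξ : ℂ, |‖ξ‖ - r| < m → ContDiffAt ℝ ∞ lg ξ := by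
    intro ξ hξ
    obtain ⟨h0, hR, hs⟩ := hann ξ hξ
    refine contDiffAt_of_exp_eq (g := g) ?_ (hg ξ h0 hR) ?_
    · refine ContinuousAt.add ?_ ((hΦc ξ h0 hR).clog hs)
      exact hLc.continuousAt.comp (Complex.continuousAt_arg_coe_angle h0)
    · have : ContinuousAt (fun ξ : ℂ => |‖ξ‖ - r|) ξ := by fun_prop
      filter_upwards [this.eventually_lt continuousAt_const hξ] with y hy using hlg y hy
  -- A bump supported where `|‖ξ‖ - r| < m` makes the logarithm globally smooth and leaves it
  -- unchanged on the inner third. The minimum keeps the outer radius below `R`.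
  refine ⟨r - m / 3, r + min (m / 3) ((R - r) / 2), by linarith, ?_, ?_, fun ξ =>
    annularBump (r - 2 * m / 3) (r - m / 3) (r + m / 3) (r + 2 * m / 3) ξ * lg ξ, ?_, ?_⟩
  · have : 0 < min (m / 3) ((R - r) / 2) := lt_min (by linarith) (by linarith)
    linarith
  · have := min_le_right (m / 3) ((R - r) / 2)
    linarith
  · rw [contDiff_iff_contDiffAt]
    intro ξ
    by_cases hξ : |‖ξ‖ - r| < m
    · exact (Complex.ofRealCLM.contDiff.comp contDiff_annularBump).contDiffAt.mul (hlgs ξ hξ)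
    · refine (contDiffAt_const (c := (0 : ℂ))).congr_of_eventuallyEq ?_
      have hc : ContinuousAt (fun ξ : ℂ => |‖ξ‖ - r|) ξ := by fun_prop
      filter_upwards [continuousAt_const.eventually_lt hc
        (show 2 * m / 3 < |‖ξ‖ - r| by linarith [not_lt.1 hξ])] with y hy
      rw [annularBump_eq_zero, Complex.ofReal_zero, zero_mul]
      · linarith
      · linarith
      · linarith
      · linarith
      · rcases lt_abs.1 hy with h | h
        · right; linarith
        · left; linarith
  · intro ξ h1 h2
    have h3 := min_le_left (m / 3) ((R - r) / 2)
    beta_reduce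
    rw [annularBump_eq_one, Complex.ofReal_one, one_mul, ← hlg]
    · rw [abs_lt]; constructor <;> linarith
    all_goals linarith

end Logarithm

/-! ### Convex integration for the operator `∂/∂ξ̄` -/

section ConvexIntegration

theorem contDiff_exp_re (c : ℂ) : ContDiff ℝ ∞ (fun ξ : ℂ => Complex.exp (c * ξ.re)) :=
  (contDiff_const.mul (Complex.ofRealCLM.comp Complex.reCLM).contDiff).cexp

theorem norm_exp_re (x y : ℝ) : ‖Complex.exp (x * Complex.I * y)‖ = 1 := by
  rw [show (x * Complex.I * y : ℂ) = ((x * y : ℝ) : ℂ) * Complex.I by push_cast; ring,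
    Complex.norm_exp_ofReal_mul_I]

/-- Adding a highly oscillating function of small size, one can change `∂F/∂ξ̄` by the values of a
family of trigonometric polynomials without constant term. -/
theorem exists_oscillation {F a b c : ℂ → ℂ} (hF : ContDiff ℝ ∞ F) (ha : ContDiff ℝ ∞ a)
    (hb : ContDiff ℝ ∞ b) (hc : ContDiff ℝ ∞ c) {K : Set ℂ} (hK : IsCompact K)
    (hne : ∀ ξ ∈ K, ∀ z : ℂ, ‖z‖ = 1 → dbar F ξ + a ξ * z⁻¹ + b ξ * z + c ξ * z ^ 2 ≠ 0)
    {η : ℝ} (hη : 0 < η) :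
    ∃ G : ℂ → ℂ, ContDiff ℝ ∞ G ∧ (∀ ξ, a ξ = 0 → b ξ = 0 → c ξ = 0 → G ξ = F ξ) ∧
      (∀ ξ ∈ K, dbar G ξ ≠ 0) ∧ ∀ ξ ∈ K, ‖G ξ - F ξ‖ ≤ η := by
  obtain ⟨m, hm, hmle⟩ : ∃ m > 0, ∀ ξ ∈ K, ∀ z : ℂ, ‖z‖ = 1 →
      m ≤ ‖dbar F ξ + a ξ * z⁻¹ + b ξ * z + c ξ * z ^ 2‖ := by
    have hcont : ContinuousOn (fun p : ℂ × ℂ =>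
        dbar F p.1 + a p.1 * p.2⁻¹ + b p.1 * p.2 + c p.1 * p.2 ^ 2)
        (K ×ˢ Metric.sphere (0 : ℂ) 1) := by
      have h1 : Continuous fun p : ℂ × ℂ => dbar F p.1 := (contDiff_dbar hF).continuous.comp continuous_fst
      have h2 : Continuous fun p : ℂ × ℂ => a p.1 := ha.continuous.comp continuous_fst
      have h3 : Continuous fun p : ℂ × ℂ => b p.1 := hb.continuous.comp continuous_fst
      have h4 : Continuous fun p : ℂ × ℂ => c p.1 := hc.continuous.comp continuous_fst
      refine ContinuousOn.add (ContinuousOn.add (h1.continuousOn.add (h2.continuousOn.mul ?_))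
        (h3.mul continuous_snd).continuousOn) (h4.mul (continuous_snd.pow 2)).continuousOn
      refine continuousOn_snd.inv₀ fun p hp => ?_
      have : ‖p.2‖ = 1 := by simpa using hp.2
      exact norm_ne_zero_iff.1 (by rw [this]; exact one_ne_zero)
    obtain ⟨m, hm, h⟩ := (hK.prod (isCompact_sphere (0 : ℂ) 1)).exists_forall_le' hcont.norm
      (a := 0) (fun p hp => norm_pos_iff.2 (hne p.1 hp.1 p.2 (by simpa using hp.2)))
    exact ⟨m, hm, fun ξ hξ z hz => h (ξ, z) ⟨hξ, by simpa using hz⟩⟩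
  -- Differentiating `exp (i k N Re ξ)` gives the factor `i k N / 2`. The constants `2i`, `-2i`,
  -- `-i` cancel `i k / 2` for `k = -1, 1, 2`.
  let A : ℂ → ℂ := fun ξ => 2 * Complex.I * a ξ
  let B : ℂ → ℂ := fun ξ => -(2 * Complex.I) * b ξ
  let C : ℂ → ℂ := fun ξ => -Complex.I * c ξ
  have hA : ContDiff ℝ ∞ A := contDiff_const.mul ha
  have hB : ContDiff ℝ ∞ B := contDiff_const.mul hb
  have hC : ContDiff ℝ ∞ C := contDiff_const.mul hc
  obtain ⟨M₁, hM₁⟩ := hK.exists_bound_of_continuousOn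
    (f := fun ξ => ‖dbar A ξ‖ + (‖dbar B ξ‖ + ‖dbar C ξ‖))
    ((contDiff_dbar hA).continuous.norm.add ((contDiff_dbar hB).continuous.norm.add (contDiff_dbar hC).continuous.norm)).continuousOn
  obtain ⟨M₂, hM₂⟩ := hK.exists_bound_of_continuousOn
    (f := fun ξ => ‖A ξ‖ + (‖B ξ‖ + ‖C ξ‖))
    (hA.continuous.norm.add (hB.continuous.norm.add hC.continuous.norm)).continuousOn
  -- After division by `N`, the derivatives of the amplitudes are an error below `m`, the distance
  -- of the loops from `0`. The added term itself is below `η`.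
  obtain ⟨N, hN1, hNm, hNη⟩ : ∃ N : ℝ, 0 < N ∧ M₁ < N * m ∧ M₂ < N * η := by
    refine ⟨max 1 (max ((M₁ + 1) / m) ((M₂ + 1) / η)), lt_max_of_lt_left one_pos, ?_, ?_⟩
    · have := (div_le_iff₀ hm).1 ((le_max_left _ _).trans
        (le_max_right 1 (max ((M₁ + 1) / m) ((M₂ + 1) / η))))
      linarith
    · have := (div_le_iff₀ hη).1 ((le_max_right _ _).trans
        (le_max_right 1 (max ((M₁ + 1) / m) ((M₂ + 1) / η))))
      linarith
  have hNC : (N : ℂ) ≠ 0 := by exact_mod_cast hN1.ne'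
  let e : ℝ → ℂ → ℂ := fun k ξ => Complex.exp (((k * N : ℝ) : ℂ) * Complex.I * ξ.re)
  have he : ∀ k, ContDiff ℝ ∞ (e k) := fun k => contDiff_exp_re _
  have hen : ∀ k ξ, ‖e k ξ‖ = 1 := fun k ξ => norm_exp_re _ _
  have hdbar : ∀ {H : ℂ → ℂ}, ContDiff ℝ ∞ H → ∀ k ξ, dbar (fun ξ => H ξ * e k ξ) ξ =
      (dbar H ξ + k * N * Complex.I / 2 * H ξ) * e k ξ := by
    intro H hH k ξ
    rw [dbar_mul (hH.contDiffAt.differentiableAt (by simp))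
      ((he k).contDiffAt.differentiableAt (by simp))]
    simp only [e]
    rw [dbar_exp_re]
    push_cast
    ring
  let Γ : ℂ → ℂ := fun ξ => A ξ * e (-1) ξ + (B ξ * e 1 ξ + C ξ * e 2 ξ)
  have hΓ : ContDiff ℝ ∞ Γ := (hA.mul (he _)).add ((hB.mul (he _)).add (hC.mul (he _)))
  have hdiff : ∀ {H : ℂ → ℂ}, ContDiff ℝ ∞ H → ∀ ξ, DifferentiableAt ℝ H ξ := fun hH ξ =>
    hH.contDiffAt.differentiableAt (by simp)
  refine ⟨fun ξ => F ξ + (N : ℂ)⁻¹ * Γ ξ, hF.add (contDiff_const.mul hΓ), ?_, ?_, ?_⟩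
  · intro ξ h1 h2 h3
    simp [Γ, A, B, C, h1, h2, h3]
  · intro ξ hξ h0
    have hΓd : dbar Γ ξ = (dbar A ξ * e (-1) ξ + dbar B ξ * e 1 ξ + dbar C ξ * e 2 ξ) +
        N * (a ξ * e (-1) ξ + b ξ * e 1 ξ + c ξ * e 2 ξ) := by
      simp only [Γ]
      rw [dbar_add (hdiff (hA.mul (he _)) ξ) (hdiff ((hB.mul (he _)).add (hC.mul (he _))) ξ),
        dbar_add (hdiff (hB.mul (he _)) ξ) (hdiff (hC.mul (he _)) ξ), hdbar hA, hdbar hB, hdbar hC]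
      simp only [A, B, C]
      push_cast
      linear_combination (-(N * (a ξ * e (-1) ξ + b ξ * e 1 ξ + c ξ * e 2 ξ))) * Complex.I_sq
    have hconst : dbar (fun _ : ℂ => (N : ℂ)⁻¹) ξ = 0 := by simp [dbar]
    have h1 : dbar (fun ξ => F ξ + (N : ℂ)⁻¹ * Γ ξ) ξ = dbar F ξ + (N : ℂ)⁻¹ * dbar Γ ξ := by
      rw [dbar_add (hdiff hF ξ) (hdiff (contDiff_const.mul hΓ) ξ),
        dbar_mul (differentiableAt_const _) (hdiff hΓ ξ), hconst, zero_mul, add_zero]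
    have hinv : e (-1) ξ = (e 1 ξ)⁻¹ := by
      simp only [e]; rw [← Complex.exp_neg]; congr 1; push_cast; ring
    have hsq : e 2 ξ = e 1 ξ ^ 2 := by
      simp only [e]; rw [← Complex.exp_nat_mul]; congr 1; push_cast; ring
    have h2 : N * (dbar F ξ + a ξ * (e 1 ξ)⁻¹ + b ξ * e 1 ξ + c ξ * e 1 ξ ^ 2) =
        -(dbar A ξ * e (-1) ξ + (dbar B ξ * e 1 ξ + dbar C ξ * e 2 ξ)) := by
      rw [h1, hΓd] at h0
      have h0' := congrArg (fun x => (N : ℂ) * x) h0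
      simp only [mul_add, mul_zero, mul_inv_cancel_left₀ hNC] at h0'
      rw [← hinv, ← hsq]
      linear_combination h0'
    have h3 : N * m ≤ ‖dbar A ξ‖ + (‖dbar B ξ‖ + ‖dbar C ξ‖) := by
      calc N * m ≤ N * ‖dbar F ξ + a ξ * (e 1 ξ)⁻¹ + b ξ * e 1 ξ + c ξ * e 1 ξ ^ 2‖ := by
            gcongr
            exact hmle ξ hξ _ (hen 1 ξ)
        _ = ‖dbar A ξ * e (-1) ξ + (dbar B ξ * e 1 ξ + dbar C ξ * e 2 ξ)‖ := by
            rw [← norm_neg (dbar A ξ * _ + _), ← h2, norm_mul, Complex.norm_real,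
              Real.norm_of_nonneg hN1.le]
        _ ≤ _ := by
            refine (norm_add_le _ _).trans (add_le_add ?_ ((norm_add_le _ _).trans ?_)) <;>
            simp [hen]
    have h4 := (le_abs_self _).trans (hM₁ ξ hξ)
    linarith
  · intro ξ hξ
    have h1 : ‖Γ ξ‖ ≤ ‖A ξ‖ + (‖B ξ‖ + ‖C ξ‖) := by
      refine (norm_add_le _ _).trans (add_le_add ?_ ((norm_add_le _ _).trans ?_)) <;> simp [hen]
    have h2 := (le_abs_self _).trans (hM₂ ξ hξ)
    rw [add_sub_cancel_left, norm_mul, norm_inv, Complex.norm_real, Real.norm_of_nonneg hN1.le,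
      inv_mul_le_iff₀ hN1]
    linarith

/-- A family of loops in `ℂ \ {0}`, contractible there, of which the member `t = 1` has mean `0`. -/
def meanLoop (t z : ℂ) : ℂ :=
  -- For `0 < t ≤ 1`, the zero and the pole of the first factor lie inside the unit circle and the
  -- zeros of the second outside, so the winding number is `0`. The constant coefficient is `1 +
  -- (3/4)(-4/3) t² = 1 - t²`, which vanishes at `t = 1`.
  (1 + 3 / 4 * t * z⁻¹) * (1 - 2 / 3 * t * z) ^ 2

theorem meanLoop_eq {t z : ℂ} (hz : z ≠ 0) : meanLoop t z =
    1 - t ^ 2 + 3 / 4 * t * z⁻¹ + (t ^ 3 / 3 - 4 / 3 * t) * z + 4 / 9 * t ^ 2 * z ^ 2 := by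
  unfold meanLoop
  field_simp
  ring

theorem norm_meanLoop_ge {t : ℝ} (ht0 : 0 ≤ t) (ht1 : t ≤ 1) {z : ℂ} (hz : ‖z‖ = 1) :
    1 / 36 ≤ ‖meanLoop t z‖ := by
  have h1 : 1 / 4 ≤ ‖1 + 3 / 4 * (t : ℂ) * z⁻¹‖ := by
    have h := norm_sub_le_norm_add (1 : ℂ) (3 / 4 * (t : ℂ) * z⁻¹)
    have h' : ‖3 / 4 * (t : ℂ) * z⁻¹‖ = 3 / 4 * t := by
      simp [hz, abs_of_nonneg ht0]
    rw [h', norm_one] at h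
    linarith
  have h2 : 1 / 3 ≤ ‖1 - 2 / 3 * (t : ℂ) * z‖ := by
    have h := norm_sub_norm_le (1 : ℂ) (2 / 3 * (t : ℂ) * z)
    have h' : ‖2 / 3 * (t : ℂ) * z‖ = 2 / 3 * t := by
      simp [hz, abs_of_nonneg ht0]
    rw [h', norm_one] at h
    linarith
  rw [meanLoop, norm_mul, norm_pow]
  calc (1 / 36 : ℝ) = 1 / 4 * (1 / 3) ^ 2 := by norm_num
    _ ≤ _ := by gcongr

/-- If two graphs over the plane, with `∂/∂ξ̄` nonzero on an annulus and homotopic there, agree with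
`η = F(ξ)` outside and with `η = F₁(ξ)` inside, they can be joined. -/
theorem exists_joining {F F₁ l u : ℂ → ℂ} (hF : ContDiff ℝ ∞ F) (hF₁ : ContDiff ℝ ∞ F₁)
    (hu : ContDiff ℝ ∞ u) (hl : ContDiff ℝ ∞ l) {s₁ s₄ : ℝ} (h0 : 0 < s₁) (h14 : s₁ < s₄)
    (hune : ∀ ξ, s₁ ≤ ‖ξ‖ → ‖ξ‖ ≤ s₄ → u ξ ≠ 0)
    (hFl : ∀ ξ, s₁ ≤ ‖ξ‖ → ‖ξ‖ ≤ s₄ → dbar F ξ = u ξ * Complex.exp (l ξ))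
    (hF₁u : ∀ ξ, s₁ ≤ ‖ξ‖ → ‖ξ‖ ≤ s₄ → dbar F₁ ξ = u ξ)
    {ρ : ℝ} (hρ : 0 < ρ) (hFρ : ∀ ξ, ‖ξ‖ ≤ s₄ → ‖F ξ‖ ≤ ρ) (hF₁ρ : ∀ ξ, ‖ξ‖ ≤ s₄ → ‖F₁ ξ‖ ≤ ρ) :
    ∃ G : ℂ → ℂ, ContDiff ℝ ∞ G ∧ (∀ ξ, ‖ξ‖ ≤ s₁ → G ξ = F₁ ξ) ∧ (∀ ξ, s₄ ≤ ‖ξ‖ → G ξ = F ξ) ∧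
      (∀ ξ, s₁ ≤ ‖ξ‖ → ‖ξ‖ ≤ s₄ → dbar G ξ ≠ 0) ∧
      ∀ ξ, s₁ ≤ ‖ξ‖ → ‖ξ‖ ≤ s₄ → ‖G ξ‖ ≤ 2 * ρ := by
  obtain ⟨s₂, h12, h24⟩ := exists_between h14
  obtain ⟨s₃, h23, h34⟩ := exists_between h24
  let χ : ℂ → ℂ := fun ξ => (radialCut s₂ s₃ ξ : ℂ)
  have hχ : ContDiff ℝ ∞ χ := Complex.ofRealCLM.contDiff.comp contDiff_radialCut
  have hχ0 : ∀ ξ : ℂ, ‖ξ‖ ≤ s₂ → χ ξ = 0 := fun ξ h => by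
    simp [χ, radialCut_eq_zero (h0.trans h12).le h23 h]
  have hχ1 : ∀ ξ : ℂ, s₃ ≤ ‖ξ‖ → χ ξ = 1 := fun ξ h => by
    simp [χ, radialCut_eq_one (h0.trans h12).le h23 h]
  -- The derivative of this interpolation is uncontrolled for `s₂ ≤ ‖ξ‖ ≤ s₃`. Elsewhere on the
  -- annulus it equals the nonvanishing `h` below, which passes from `u` to `u * exp l`.
  let F₀ : ℂ → ℂ := fun ξ => χ ξ * F ξ + (1 - χ ξ) * F₁ ξ
  have hF₀ : ContDiff ℝ ∞ F₀ := (hχ.mul hF).add ((contDiff_const.sub hχ).mul hF₁)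
  let h : ℂ → ℂ := fun ξ => u ξ * Complex.exp (χ ξ * l ξ)
  have hh : ContDiff ℝ ∞ h := hu.mul (hχ.mul hl).cexp
  have hhne : ∀ ξ, s₁ ≤ ‖ξ‖ → ‖ξ‖ ≤ s₄ → h ξ ≠ 0 := fun ξ h1 h2 =>
    mul_ne_zero (hune ξ h1 h2) (Complex.exp_ne_zero _)
  have hw : ∀ ξ, s₁ ≤ ‖ξ‖ → ‖ξ‖ ≤ s₄ → ‖ξ‖ < s₂ ∨ s₃ < ‖ξ‖ → dbar F₀ ξ = h ξ := by
    intro ξ h1 h2 h3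
    rcases h3 with h3 | h3
    · have : F₀ =ᶠ[𝓝 ξ] F₁ := by
        filter_upwards [continuous_norm.continuousAt.eventually_lt continuousAt_const h3] with y hy
        simp [F₀, hχ0 y hy.le]
      rw [dbar_congr this, hF₁u ξ h1 h2]
      simp [h, hχ0 ξ h3.le]
    · have : F₀ =ᶠ[𝓝 ξ] F := by
        filter_upwards [continuousAt_const.eventually_lt continuous_norm.continuousAt h3] with y hy
        simp [F₀, hχ1 y hy.le]
      rw [dbar_congr this, hFl ξ h1 h2]
      simp [h, hχ1 ξ h3.le]
  let K : Set ℂ := {ξ | s₁ ≤ ‖ξ‖ ∧ ‖ξ‖ ≤ s₄}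
  have hK : IsCompact K := by
    refine (isCompact_closedBall (0 : ℂ) s₄).of_isClosed_subset ?_ fun ξ hξ => by simpa using hξ.2
    exact (isClosed_le continuous_const continuous_norm).inter
      (isClosed_le continuous_norm continuous_const)
  obtain ⟨κ, hκ⟩ := hK.exists_bound_of_continuousOn
    (f := fun ξ => (dbar F₀ ξ - h ξ) / h ξ)
    (((contDiff_dbar hF₀).continuous.sub hh.continuous).continuousOn.div hh.continuous.continuousOn
      fun ξ hξ => hhne ξ hξ.1 hξ.2)
  -- The closer `t₀` is to `1`, the smaller the mean of the loop compared with its distance from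
  -- `0`, which is at least `1 / 36`. After scaling the mean to `h`, the loop is far enough from `0`
  -- to absorb the error `dbar F₀ - h`.
  obtain ⟨t₀, ht0, ht1, htκ⟩ : ∃ t₀ : ℝ, 0 ≤ t₀ ∧ t₀ < 1 ∧ κ * (1 - t₀ ^ 2) < 1 / 36 := by
    refine ⟨Real.sqrt (1 - 1 / (36 * |κ| + 2)), Real.sqrt_nonneg _, ?_, ?_⟩
    · rw [Real.sqrt_lt' one_pos]
      have : 0 < 1 / (36 * |κ| + 2) := by positivity
      linarith
    · rw [Real.sq_sqrt]
      · rw [sub_sub_cancel, mul_one_div, div_lt_div_iff₀ (by positivity) (by norm_num)]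
        have := le_abs_self κ
        linarith
      · rw [sub_nonneg, div_le_one (by positivity)]
        have := abs_nonneg κ
        linarith
  let τ : ℂ → ℝ := fun ξ => t₀ * annularBump s₁ s₂ s₃ s₄ ξ
  let t : ℂ → ℂ := fun ξ => (τ ξ : ℂ)
  have ht : ContDiff ℝ ∞ t :=
    Complex.ofRealCLM.contDiff.comp (contDiff_const.mul contDiff_annularBump)
  have hτ0 : ∀ ξ, 0 ≤ τ ξ := fun ξ => mul_nonneg ht0 annularBump_mem_Icc.1
  have hτ1 : ∀ ξ, τ ξ < 1 := fun ξ =>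
    (mul_le_of_le_one_right ht0 annularBump_mem_Icc.2).trans_lt ht1
  have hτsq : ∀ ξ, 0 < 1 - τ ξ ^ 2 := fun ξ => by
    have := pow_lt_one₀ (hτ0 ξ) (hτ1 ξ) two_ne_zero
    linarith
  have htsq : ∀ ξ, 1 - t ξ ^ 2 ≠ 0 := fun ξ => by
    have := (hτsq ξ).ne'
    simp only [t]
    exact_mod_cast this
  have htz : ∀ ξ : ℂ, ‖ξ‖ ≤ s₁ ∨ s₄ ≤ ‖ξ‖ → t ξ = 0 := fun ξ h => by
    simp [t, τ, annularBump_eq_zero h0.le h12 h23.le h34 h]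
  -- With this scaling `A * meanLoop t` has constant term `h`. Adding its other terms to `dbar F₀`
  -- gives `(dbar F₀ - h) + A * meanLoop t`.
  let A : ℂ → ℂ := fun ξ => h ξ * (1 - t ξ ^ 2)⁻¹
  have hA : ContDiff ℝ ∞ A := hh.mul ((contDiff_const.sub (ht.pow 2)).inv htsq)
  obtain ⟨G, hG, hGeq, hGne, hGη⟩ := exists_oscillation (F := F₀)
    (a := fun ξ => A ξ * (3 / 4 * t ξ)) (b := fun ξ => A ξ * (t ξ ^ 3 / 3 - 4 / 3 * t ξ))
    (c := fun ξ => A ξ * (4 / 9 * t ξ ^ 2)) hF₀ (hA.mul (contDiff_const.mul ht))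
    (hA.mul (((ht.pow 3).div_const _).sub (contDiff_const.mul ht)))
    (hA.mul (contDiff_const.mul (ht.pow 2))) hK (η := ρ) (by
      intro ξ hξ z hz hzero
      have hz0 : z ≠ 0 := norm_ne_zero_iff.1 (by rw [hz]; exact one_ne_zero)
      have hhξ := hhne ξ hξ.1 hξ.2
      have hAh : A ξ * (1 - t ξ ^ 2) = h ξ := inv_mul_cancel_right₀ (htsq ξ) _
      have key : (dbar F₀ ξ - h ξ) + A ξ * meanLoop (t ξ) z = 0 := by
        rw [meanLoop_eq hz0]
        linear_combination hzero + hAh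
      have hq := norm_meanLoop_ge (hτ0 ξ) (hτ1 ξ).le hz
      -- Where `t` varies, the error `dbar F₀ - h` is zero and it suffices that the loops avoid `0`.
      -- Where there may be an error, `t = t₀` and the loop is large enough.
      by_cases hmid : ‖ξ‖ < s₂ ∨ s₃ < ‖ξ‖
      · rw [hw ξ hξ.1 hξ.2 hmid, sub_self, zero_add, mul_eq_zero] at key
        rcases key with key | key
        · exact mul_ne_zero hhξ (inv_ne_zero (htsq ξ)) key
        · simp only [t] at key
          rw [key, norm_zero] at hq
          linarith
      · push Not at hmid
        have hτ : τ ξ = t₀ := by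
          simp [τ, annularBump_eq_one h0.le h12 h23.le h34 hmid.1 hmid.2]
        have h1 : meanLoop (t ξ) z = -((dbar F₀ ξ - h ξ) / h ξ) * (1 - t ξ ^ 2) := by
          rw [← mul_right_inj' hhξ]
          have : h ξ * meanLoop (t ξ) z = (A ξ * meanLoop (t ξ) z) * (1 - t ξ ^ 2) := by
            rw [← hAh]; ring
          rw [this, eq_neg_of_add_eq_zero_right key]
          field_simp
        have h2 : ‖(1 - t ξ ^ 2 : ℂ)‖ = 1 - t₀ ^ 2 := by
          have : (1 - t ξ ^ 2 : ℂ) = ((1 - t₀ ^ 2 : ℝ) : ℂ) := by simp [t, hτ]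
          rw [this, Complex.norm_real, Real.norm_of_nonneg]
          have := hτsq ξ
          rw [hτ] at this
          exact this.le
        have h3 : ‖meanLoop (t ξ) z‖ ≤ κ * (1 - t₀ ^ 2) := by
          rw [h1, norm_mul, norm_neg, h2]
          have := hτsq ξ
          rw [hτ] at this
          exact mul_le_mul_of_nonneg_right (hκ ξ hξ) this.le
        linarith) hρ
  refine ⟨G, hG, fun ξ hξ => ?_, fun ξ hξ => ?_, fun ξ h1 h2 => hGne ξ ⟨h1, h2⟩, fun ξ h1 h2 => ?_⟩
  · have := htz ξ (Or.inl hξ)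
    rw [hGeq ξ (by simp [this]) (by simp [this]) (by simp [this])]
    simp [F₀, hχ0 ξ (hξ.trans h12.le)]
  · have := htz ξ (Or.inr hξ)
    rw [hGeq ξ (by simp [this]) (by simp [this]) (by simp [this])]
    simp [F₀, hχ1 ξ (h34.le.trans hξ)]
  · have hcut := radialCut_mem_Icc (a := s₂) (b := s₃) (ξ := ξ)
    have h3 : ‖F₀ ξ‖ ≤ ρ := by
      have h4 : ‖χ ξ‖ = radialCut s₂ s₃ ξ := by
        simp only [χ]; rw [Complex.norm_real, Real.norm_of_nonneg hcut.1]
      have h5 : ‖1 - χ ξ‖ = 1 - radialCut s₂ s₃ ξ := by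
        simp only [χ]
        rw [← Complex.ofReal_one, ← Complex.ofReal_sub, Complex.norm_real,
          Real.norm_of_nonneg (by linarith [hcut.2])]
      calc ‖F₀ ξ‖ ≤ ‖χ ξ * F ξ‖ + ‖(1 - χ ξ) * F₁ ξ‖ := norm_add_le _ _
        _ = radialCut s₂ s₃ ξ * ‖F ξ‖ + (1 - radialCut s₂ s₃ ξ) * ‖F₁ ξ‖ := by
            rw [norm_mul, norm_mul, h4, h5]
        _ ≤ radialCut s₂ s₃ ξ * ρ + (1 - radialCut s₂ s₃ ξ) * ρ := by
            have := hFρ ξ h2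
            have := hF₁ρ ξ h2
            have := hcut.1
            have : 0 ≤ 1 - radialCut s₂ s₃ ξ := by linarith [hcut.2]
            gcongr
        _ = ρ := by ring
    have h6 := norm_add_le (F₀ ξ) (G ξ - F₀ ξ)
    rw [add_sub_cancel] at h6
    have := hGη ξ ⟨h1, h2⟩
    linarith

/-- Near a point where `∂F/∂ξ̄` has winding number `-1`, the graph of `F` can be changed into that of
`η = ξ̄²` around the point, without new complex points. -/
theorem exists_eq_conj_sq_near_zero {F : ℂ → ℂ} (hF : ContDiff ℝ ∞ F) {R : ℝ}
    (hne : ∀ ξ, ξ ≠ 0 → ‖ξ‖ < R → dbar F ξ ≠ 0) {r : ℝ} (hr : 0 < r) (hrR : r < R)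
    (hw : HasWindingNumber (fun t => dbar F (r * Complex.exp (t * Complex.I))) (-1)) {ρ : ℝ}
    (hFρ : ∀ ξ, ‖ξ‖ < R → ‖F ξ‖ ≤ ρ) (hRρ : R ^ 2 ≤ ρ) :
    ∃ G : ℂ → ℂ, ContDiff ℝ ∞ G ∧ ∃ δ ε : ℝ, 0 < δ ∧ δ < ε ∧ ε < R ∧
      (∀ ξ, ‖ξ‖ ≤ δ → G ξ = conj ξ ^ 2) ∧ (∀ ξ, ε ≤ ‖ξ‖ → G ξ = F ξ) ∧
      (∀ ξ, ξ ≠ 0 → ‖ξ‖ < R → dbar G ξ ≠ 0) ∧ ∀ ξ, ‖ξ‖ < R → ‖G ξ‖ ≤ 2 * ρ := by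
  have hR : 0 < R := hr.trans hrR
  have hρ : 0 < ρ := (by positivity : (0 : ℝ) < R ^ 2).trans_le hRρ
  have hu : ContDiff ℝ ∞ (fun ξ : ℂ => 2 * conj ξ) := contDiff_const.mul contDiff_conj
  have hune : ∀ ξ : ℂ, ξ ≠ 0 → 2 * conj ξ ≠ 0 := fun ξ hξ =>
    mul_ne_zero two_ne_zero (by simpa using hξ)
  have hw' : HasWindingNumber
      (fun t => (fun ξ => dbar F ξ / (2 * conj ξ)) (r * Complex.exp (t * Complex.I))) 0 := by
    obtain ⟨l, hlc, hl, hl2⟩ := hw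
    -- On the circle of radius `r`, `log (2r) - it` is a logarithm of `2ξ̄`. Subtracting it cancels
    -- the winding number `-1`.
    refine ⟨fun t => l t + (t * Complex.I - (Real.log (2 * r) : ℂ)), ?_, fun t ht => ?_, ?_⟩
    · exact hlc.add (by fun_prop)
    · have h2r : Complex.exp (Real.log (2 * r) : ℂ) = 2 * r := by
        rw [← Complex.ofReal_exp, Real.exp_log (by linarith)]; push_cast; ring
      have hrC : (r : ℂ) ≠ 0 := by exact_mod_cast hr.ne'
      simp only
      rw [Complex.exp_add, Complex.exp_sub, h2r, ← hl t ht, map_mul, Complex.conj_ofReal,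
        ← Complex.exp_conj, map_mul, Complex.conj_ofReal, Complex.conj_I, mul_neg, Complex.exp_neg]
      have := Complex.exp_ne_zero (t * Complex.I)
      field_simp
    · push_cast at hl2 ⊢
      linear_combination hl2
  obtain ⟨s₁, s₄, h0, h14, h4R, l, hl, hgl⟩ := exists_log_on_annulus
    (g := fun ξ => dbar F ξ / (2 * conj ξ)) hr hrR
    (fun ξ hξ _ => by
      simp only [div_eq_mul_inv]
      exact (contDiff_dbar hF).contDiffAt.mul (hu.contDiffAt.inv (hune ξ hξ))) hw'
  have hpos : ∀ ξ : ℂ, s₁ ≤ ‖ξ‖ → ξ ≠ 0 := fun ξ h => norm_pos_iff.1 (h0.trans_le h)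
  have hsq : ∀ ξ : ℂ, ‖ξ‖ < R → ‖conj ξ ^ 2‖ ≤ ρ := fun ξ h => by
    rw [norm_pow, Complex.norm_conj]
    exact (pow_le_pow_left₀ (norm_nonneg _) h.le 2).trans hRρ
  obtain ⟨G, hG, hG₁, hG₄, hGne, hGρ⟩ := exists_joining hF (contDiff_conj.pow 2) hu hl h0 h14
    (fun ξ h _ => hune ξ (hpos ξ h))
    (fun ξ h1 h2 => by rw [← hgl ξ h1 h2, mul_div_cancel₀ _ (hune ξ (hpos ξ h1))])
    (fun ξ _ _ => dbar_conj_sq) hρ (fun ξ h => hFρ ξ (h.trans_lt h4R))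
    (fun ξ h => hsq ξ (h.trans_lt h4R))
  refine ⟨G, hG, s₁, s₄, h0, h14, h4R, hG₁, hG₄, fun ξ hξ hξR => ?_, fun ξ hξR => ?_⟩
  · rcases lt_or_ge ‖ξ‖ s₁ with h1 | h1
    · have : G =ᶠ[𝓝 ξ] fun ξ => conj ξ ^ 2 := by
        filter_upwards [continuous_norm.continuousAt.eventually_lt continuousAt_const h1] with y hy
        exact hG₁ y hy.le
      rw [dbar_congr this, dbar_conj_sq]
      exact hune ξ hξ
    · rcases le_or_gt ‖ξ‖ s₄ with h2 | h2
      · exact hGne ξ h1 h2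
      · have : G =ᶠ[𝓝 ξ] F := by
          filter_upwards [continuousAt_const.eventually_lt continuous_norm.continuousAt h2]
            with y hy
          exact hG₄ y hy.le
        rw [dbar_congr this]
        exact hne ξ hξ hξR
  · rcases le_total ‖ξ‖ s₁ with h1 | h1
    · rw [hG₁ ξ h1]
      linarith [hsq ξ hξR]
    · rcases le_total ‖ξ‖ s₄ with h2 | h2
      · exact hGρ ξ h1 h2
      · rw [hG₄ ξ h2]
        linarith [hFρ ξ hξR]

end ConvexIntegration

/-! ### A totally real cross-cap in `ℂ²` -/

section Profile

/-- A smooth function, positive on `[0, ∞)`, with `profile δ y = y` for `δ ≤ y`. -/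
def profile (δ y : ℝ) : ℝ :=
  y + δ * Real.smoothTransition (1 - y / δ)

variable {δ y : ℝ}

theorem contDiff_profile : ContDiff ℝ ∞ (profile δ) :=
  contDiff_id.add (contDiff_const.mul
    (Real.smoothTransition.contDiff.comp (contDiff_const.sub (contDiff_id.div_const δ))))

theorem profile_eq_self (hδ : 0 < δ) (h : δ ≤ y) : profile δ y = y := by
  have h1 : 1 ≤ y / δ := (one_le_div hδ).2 h
  rw [profile, Real.smoothTransition.zero_of_nonpos (by linarith), mul_zero, add_zero]

theorem le_profile (hδ : 0 < δ) : y ≤ profile δ y :=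
  le_add_of_nonneg_right (mul_nonneg hδ.le (Real.smoothTransition.nonneg _))

theorem profile_pos (hδ : 0 < δ) (hy : 0 ≤ y) : 0 < profile δ y := by
  rcases lt_or_ge y δ with h | h
  · have h1 : y / δ < 1 := (div_lt_one hδ).2 h
    have := mul_pos hδ (Real.smoothTransition.pos_of_pos (x := 1 - y / δ) (by linarith))
    rw [profile]
    linarith
  · rw [profile_eq_self hδ h]
    linarith

theorem profile_le (hδ : 0 < δ) (hy : y ≤ δ) : profile δ y ≤ 2 * δ := by
  have := mul_le_of_le_one_right hδ.le (Real.smoothTransition.le_one (1 - y / δ))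
  rw [profile]
  linarith

end Profile

section Model

/-- A totally real Möbius strip in `ℂ²`, which coincides with the graph of `η = ξ̄²` outside a
compact set. -/
def modelCrossCap (δ : ℝ) : Set (ℂ × ℂ) :=
  {p | ∃ y : ℝ, 0 ≤ y ∧ p.1 ^ 2 * p.2 = y ∧ ‖p.2‖ ^ 2 = profile δ y}

variable {δ : ℝ} {ξ η : ℂ}

theorem snd_ne_zero_of_mem_modelCrossCap (hδ : 0 < δ) (h : (ξ, η) ∈ modelCrossCap δ) : η ≠ 0 := by
  obtain ⟨y, hy, -, h2⟩ := h
  rintro rfl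
  have := profile_pos hδ hy
  simp at h2
  linarith

theorem sq_eq_of_mul_eq {y : ℝ} (hy : 0 ≤ y) (h1 : ξ ^ 2 * η = y) (h2 : ‖η‖ ^ 2 = profile δ y) :
    y ^ 2 = ‖ξ‖ ^ 4 * profile δ y := by
  have h := congrArg norm h1
  rw [norm_mul, norm_pow, Complex.norm_real, Real.norm_of_nonneg hy] at h
  rw [← h2, ← h]
  ring

/-- With `Q = profile δ`, `y² = ‖ξ‖⁴ Q(y) ≥ δ Q(y) ≥ δ y`, and `y ≠ 0`, so `y ≥ δ` and `Q(y) = y`.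
Then `η̄ η = y = ξ² η`, and `η` can be cancelled. -/
theorem mem_modelCrossCap_iff (hδ : 0 < δ) (hξ : δ ≤ ‖ξ‖ ^ 4) :
    (ξ, η) ∈ modelCrossCap δ ↔ η = conj ξ ^ 2 := by
  constructor
  · rintro ⟨y, hy, h1, h2⟩
    have hQ := profile_pos hδ hy
    have hyQ := sq_eq_of_mul_eq hy h1 h2
    have hyδ : δ ≤ y := by
      have h3 : δ * y ≤ δ * profile δ y := mul_le_mul_of_nonneg_left (le_profile hδ) hδ.le
      have h4 : δ * profile δ y ≤ ‖ξ‖ ^ 4 * profile δ y := mul_le_mul_of_nonneg_right hξ hQ.le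
      have hy0 : 0 < y := by
        refine lt_of_le_of_ne hy fun h0 => ?_
        subst h0
        have := mul_pos hδ hQ
        linarith
      nlinarith
    rw [profile_eq_self hδ hyδ] at h2
    have hη : η ≠ 0 := by
      rintro rfl
      simp at h2
      linarith
    have h3 : conj η * η = ξ ^ 2 * η := by
      rw [mul_comm, Complex.mul_conj, Complex.normSq_eq_norm_sq, h2]
      exact h1.symm
    have h4 := mul_right_cancel₀ hη h3
    rw [← Complex.conj_conj η]
    rw [h4, map_pow]
  · rintro rfl
    have h1 : ξ ^ 2 * conj ξ ^ 2 = ((‖ξ‖ ^ 4 : ℝ) : ℂ) := by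
      rw [← mul_pow, Complex.mul_conj, Complex.normSq_eq_norm_sq]
      push_cast
      ring
    refine ⟨‖ξ‖ ^ 4, by positivity, h1, ?_⟩
    rw [profile_eq_self hδ hξ]
    simp
    ring

theorem norm_sq_le_of_mem_modelCrossCap (hδ : 0 < δ) (hξ : ‖ξ‖ ^ 4 ≤ δ)
    (h : (ξ, η) ∈ modelCrossCap δ) : ‖η‖ ^ 2 ≤ 2 * δ := by
  obtain ⟨y, hy, h1, h2⟩ := h
  have hyQ := sq_eq_of_mul_eq hy h1 h2
  simp only at h2
  rw [h2]
  refine profile_le hδ ?_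
  by_contra! hlt
  rw [profile_eq_self hδ hlt.le] at hyQ
  nlinarith [mul_le_mul_of_nonneg_right hξ hy]

/-! #### Flattening coordinates -/

/-- The shear `(ξ, η) ↦ (ξ, η + H ξ)`. -/
def shear (H : ℂ → ℂ) (hH : Continuous H) : (ℂ × ℂ) ≃ₜ (ℂ × ℂ) where
  toFun p := (p.1, p.2 + H p.1)
  invFun p := (p.1, p.2 - H p.1)
  left_inv p := by simp
  right_inv p := by simp

theorem shear_mem_contDiffGroupoid {H : ℂ → ℂ} (hH : ContDiff ℝ ∞ H) :
    (shear H hH.continuous).toOpenPartialHomeomorph ∈ contDiffGroupoid ∞ 𝓘(ℝ, ℂ × ℂ) := by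
  have h : ContDiff ℝ ∞ fun p : ℂ × ℂ => H p.1 := hH.comp contDiff_fst
  exact mem_contDiffGroupoid_self_iff.2
    ⟨(contDiff_fst.prodMk (contDiff_snd.add h)).contDiffOn,
      (contDiff_fst.prodMk (contDiff_snd.sub h)).contDiffOn⟩

/-- The holomorphic coordinates `(ξ √η, log √η)` near the points of `ℂ × {c}`, `c ≠ 0`. -/
def logCoordinates (c : ℂ) (hc : c ≠ 0) : OpenPartialHomeomorph (ℂ × ℂ) (ℂ × ℂ) where
  toFun p := (p.1 * Complex.exp ((Complex.log c + Complex.log (p.2 / c)) / 2),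
    (Complex.log c + Complex.log (p.2 / c)) / 2)
  invFun q := (q.1 * Complex.exp (-q.2), Complex.exp (2 * q.2))
  -- Dividing by `c` turns the branch cut away from `c`, so every nonzero `c` is allowed, also on
  -- the negative axis.
  source := {p | p.2 / c ∈ Complex.slitPlane}
  target := {q | (2 * q.2 - Complex.log c).im ∈ Ioo (-Real.pi) Real.pi}
  map_source' p hp := by
    have hp' : p.2 / c ∈ Complex.slitPlane := hp
    have h : 2 * ((Complex.log c + Complex.log (p.2 / c)) / 2) - Complex.log c =
      Complex.log (p.2 / c) := by ring
    rw [mem_ofPred_eq, h, Complex.log_im]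
    exact ⟨Complex.neg_pi_lt_arg _, lt_of_le_of_ne (Complex.arg_le_pi _)
      (Complex.mem_slitPlane_iff_arg.1 hp').1⟩
  map_target' q hq := by
    have hq' : (2 * q.2 - Complex.log c).im ∈ Ioo (-Real.pi) Real.pi := hq
    have h : Complex.exp (2 * q.2) / c = Complex.exp (2 * q.2 - Complex.log c) := by
      rw [Complex.exp_sub, Complex.exp_log hc]
    rw [mem_ofPred_eq, h, Complex.mem_slitPlane_iff_arg, ← Complex.log_im,
      Complex.log_exp hq'.1 hq'.2.le]
    exact ⟨hq'.2.ne, Complex.exp_ne_zero _⟩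
  left_inv' p hp := by
    have hp0 : p.2 / c ≠ 0 := Complex.slitPlane_ne_zero hp
    refine Prod.ext ?_ ?_
    · simp only
      rw [mul_assoc, ← Complex.exp_add, add_neg_cancel, Complex.exp_zero, mul_one]
    · simp only
      rw [mul_div_cancel₀ _ two_ne_zero, Complex.exp_add, Complex.exp_log hc, Complex.exp_log hp0,
        mul_div_cancel₀ _ hc]
  right_inv' q hq := by
    have hq' : (2 * q.2 - Complex.log c).im ∈ Ioo (-Real.pi) Real.pi := hq
    have h : Complex.exp (2 * q.2) / c = Complex.exp (2 * q.2 - Complex.log c) := by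
      rw [Complex.exp_sub, Complex.exp_log hc]
    have h2 : (Complex.log c + Complex.log (Complex.exp (2 * q.2) / c)) / 2 = q.2 := by
      rw [h, Complex.log_exp hq'.1 hq'.2.le]
      ring
    simp only [h2]
    rw [mul_assoc, ← Complex.exp_add, neg_add_cancel, Complex.exp_zero, mul_one]
  open_source := Complex.isOpen_slitPlane.preimage (continuous_snd.div_const c)
  open_target := isOpen_Ioo.preimage (by fun_prop)
  continuousOn_toFun := by
    have h : ContinuousOn (fun p : ℂ × ℂ => (Complex.log c + Complex.log (p.2 / c)) / 2)
        {p | p.2 / c ∈ Complex.slitPlane} :=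
      ((continuousOn_const.add ((continuous_snd.div_const c).continuousOn.clog
        fun p hp => hp)).div_const 2)
    exact (continuousOn_fst.mul h.cexp).prodMk h
  continuousOn_invFun := by fun_prop

theorem logCoordinates_mem_contDiffGroupoid (c : ℂ) (hc : c ≠ 0) :
    logCoordinates c hc ∈ contDiffGroupoid ∞ 𝓘(ℝ, ℂ × ℂ) := by
  refine mem_contDiffGroupoid_self_iff.2 ⟨?_, ?_⟩
  · have h : ContDiffOn ℂ ∞ (fun p : ℂ × ℂ => (Complex.log c + Complex.log (p.2 / c)) / 2)
        {p | p.2 / c ∈ Complex.slitPlane} := by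
      refine (contDiffOn_const.add ?_).div_const 2
      exact fun p hp => ((Complex.contDiffAt_log (n := ∞) hp).comp p
        ((contDiff_snd.div_const c).contDiffAt)).contDiffWithinAt
    exact ((contDiffOn_fst.mul h.cexp).prodMk h).restrict_scalars ℝ
  · have h : ContDiff ℂ ∞ (fun q : ℂ × ℂ => (q.1 * Complex.exp (-q.2), Complex.exp (2 * q.2))) := by
      fun_prop
    exact (h.restrict_scalars ℝ).contDiffOn

/-- Coordinates of `ℂ²` in which the totally real surface `Im Z = 0`, `Re W = g (Re Z)` is flat. -/
def realGraphCoordinates (g : ℝ → ℝ) (hg : Continuous g) : (ℂ × ℂ) ≃ₜ (ℂ × ℂ) where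
  toFun p := (p.1.re + p.2.im * Complex.I, p.1.im + (p.2.re - g p.1.re : ℝ) * Complex.I)
  invFun q := (q.1.re + q.2.re * Complex.I, (q.2.im + g q.1.re : ℝ) + q.1.im * Complex.I)
  left_inv p := by
    ext1 <;> apply Complex.ext <;> simp
  right_inv q := by
    ext1 <;> apply Complex.ext <;> simp
  continuous_toFun := by fun_prop
  continuous_invFun := by fun_prop

theorem realGraphCoordinates_mem_contDiffGroupoid {g : ℝ → ℝ} (hg : ContDiff ℝ ∞ g) :
    (realGraphCoordinates g hg.continuous).toOpenPartialHomeomorph ∈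
      contDiffGroupoid ∞ 𝓘(ℝ, ℂ × ℂ) := by
  have re : ContDiff ℝ ∞ Complex.re := Complex.reCLM.contDiff
  have im : ContDiff ℝ ∞ Complex.im := Complex.imCLM.contDiff
  have ofReal : ContDiff ℝ ∞ (fun x : ℝ => (x : ℂ)) := Complex.ofRealCLM.contDiff
  refine mem_contDiffGroupoid_self_iff.2 ⟨ContDiff.contDiffOn ?_, ContDiff.contDiffOn ?_⟩
  · exact ContDiff.prodMk ((ofReal.comp (re.comp contDiff_fst)).add
      ((ofReal.comp (im.comp contDiff_snd)).mul contDiff_const))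
      ((ofReal.comp (im.comp contDiff_fst)).add ((ofReal.comp ((re.comp contDiff_snd).sub
        (hg.comp (re.comp contDiff_fst)))).mul contDiff_const))
  · exact ContDiff.prodMk ((ofReal.comp (re.comp contDiff_fst)).add
      ((ofReal.comp (re.comp contDiff_snd)).mul contDiff_const))
      ((ofReal.comp ((im.comp contDiff_snd).add (hg.comp (re.comp contDiff_fst)))).add
        ((ofReal.comp (im.comp contDiff_fst)).mul contDiff_const))

theorem im_eq_zero_of_sq_eq {Z : ℂ} {y : ℝ} (hy : 0 ≤ y) (h : Z ^ 2 = y) :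
    Z.im = 0 ∧ Z.re ^ 2 = y := by
  have hre : Z.re * Z.re - Z.im * Z.im = y := by
    have := congrArg Complex.re h
    simpa [pow_two] using this
  have him : Z.re * Z.im + Z.im * Z.re = 0 := by
    have := congrArg Complex.im h
    simpa [pow_two] using this
  have h0 : Z.im = 0 := by
    have : Z.re * Z.im = 0 := by linarith
    rcases mul_eq_zero.1 this with h | h
    · rw [h] at hre
      nlinarith
    · exact h
  refine ⟨h0, ?_⟩
  rw [h0] at hre
  linarith

/-- In `Z = ξ√η`, `W = log √η` the equations say that `Z² = y ≥ 0`, so `Z` is real, and that `4 Re W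
= log Q(Z²)` with `Q = profile δ`. This is a graph over the real `Z`-axis, smooth also at `Z = 0`
because `Q(0) > 0`. -/
theorem exists_flattening_modelCrossCap (hδ : 0 < δ) {p : ℂ × ℂ} (hp : p ∈ modelCrossCap δ) :
    ∃ ψ ∈ contDiffGroupoid ∞ 𝓘(ℝ, ℂ × ℂ), p ∈ ψ.source ∧
      ∀ x ∈ ψ.source, x ∈ modelCrossCap δ ↔ (ψ x).2 = 0 := by
  have hp0 : p.2 ≠ 0 := snd_ne_zero_of_mem_modelCrossCap hδ hp
  have hg : ContDiff ℝ ∞ fun x : ℝ => Real.log (profile δ (x ^ 2)) / 4 :=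
    ((contDiff_profile.comp (contDiff_id.pow 2)).log
      fun x => (profile_pos hδ (sq_nonneg x)).ne').div_const 4
  refine ⟨(logCoordinates p.2 hp0).trans
    (realGraphCoordinates _ hg.continuous).toOpenPartialHomeomorph,
    StructureGroupoid.trans _ (logCoordinates_mem_contDiffGroupoid _ _)
      (realGraphCoordinates_mem_contDiffGroupoid hg), ?_, ?_⟩
  · simp [logCoordinates, hp0]
  · rintro ⟨ξ, η⟩ hx
    have hx' : η / p.2 ∈ Complex.slitPlane := by
      simpa [logCoordinates] using hx
    set W := (Complex.log p.2 + Complex.log (η / p.2)) / 2 with hW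
    have hexp : Complex.exp W ^ 2 = η := by
      rw [← Complex.exp_nat_mul, hW, Nat.cast_ofNat, mul_div_cancel₀ _ two_ne_zero, Complex.exp_add,
        Complex.exp_log hp0, Complex.exp_log (Complex.slitPlane_ne_zero hx'), mul_div_cancel₀ _ hp0]
    set Z := ξ * Complex.exp W with hZ
    have hZ2 : Z ^ 2 = ξ ^ 2 * η := by rw [hZ, mul_pow, hexp]
    have hη : ‖η‖ ^ 2 = Real.exp (4 * W.re) := by
      rw [← hexp, norm_pow, Complex.norm_exp, ← pow_mul, ← Real.exp_nat_mul]
      norm_num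
    have hval : (((logCoordinates p.2 hp0).trans
        (realGraphCoordinates _ hg.continuous).toOpenPartialHomeomorph) (ξ, η)).2 =
        (Z.im : ℂ) + ((W.re - Real.log (profile δ (Z.re ^ 2)) / 4 : ℝ) : ℂ) * Complex.I := rfl
    rw [hval, Complex.ext_iff]
    simp only [Complex.add_re, Complex.ofReal_re, Complex.re_ofReal_mul, Complex.I_re, mul_zero,
      add_zero, Complex.zero_re, Complex.add_im, Complex.ofReal_im, Complex.im_ofReal_mul,
      Complex.I_im, mul_one, zero_add, Complex.zero_im]
    have hQ := profile_pos hδ (sq_nonneg Z.re)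
    constructor
    · rintro ⟨y, hy, h1, h2⟩
      obtain ⟨h3, rfl⟩ := im_eq_zero_of_sq_eq hy (hZ2.trans h1)
      refine ⟨h3, ?_⟩
      simp only at h2
      rw [← h2, hη, Real.log_exp]
      ring
    · rintro ⟨h1, h2⟩
      refine ⟨Z.re ^ 2, sq_nonneg _, ?_, ?_⟩
      · rw [← hZ2]
        have : Z = (Z.re : ℂ) := Complex.ext rfl (by simpa using h1)
        rw [this]
        simp
      · simp only
        rw [hη, show 4 * W.re = Real.log (profile δ (Z.re ^ 2)) by linarith, Real.exp_log hQ]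

/-! #### Total reality -/

/-- The velocities of curves in `T` through `q`. -/
def velocities (T : Set (ℂ × ℂ)) (q : ℂ × ℂ) : Set (ℂ × ℂ) :=
  {v | ∃ c : ℝ → ℂ × ℂ, c 0 = q ∧ (∀ᶠ t in 𝓝 0, c t ∈ T) ∧ HasDerivAt c v 0}

theorem velocities_subset {T T' : Set (ℂ × ℂ)} {q : ℂ × ℂ} (h : ∀ᶠ x in 𝓝 q, x ∈ T → x ∈ T') :
    velocities T q ⊆ velocities T' q := by
  rintro v ⟨c, hc0, hcT, hc⟩
  refine ⟨c, hc0, ?_, hc⟩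
  have h' : ∀ᶠ t in 𝓝 (0 : ℝ), c t ∈ T → c t ∈ T' := hc.continuousAt.eventually (by rwa [hc0])
  filter_upwards [hcT, h'] with t ht ht' using ht' ht

theorem hasDerivAt_fst_snd {c : ℝ → ℂ × ℂ} {v : ℂ × ℂ} (h : HasDerivAt c v 0) :
    HasDerivAt (fun t => (c t).1) v.1 0 ∧ HasDerivAt (fun t => (c t).2) v.2 0 :=
  ⟨(hasFDerivAt_fst (𝕜 := ℝ) (E := ℂ) (F := ℂ)).comp_hasDerivAt (0 : ℝ) h,
    (hasFDerivAt_snd (𝕜 := ℝ) (E := ℂ) (F := ℂ)).comp_hasDerivAt (0 : ℝ) h⟩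

theorem velocities_graph {G : ℂ → ℂ} {q : ℂ × ℂ} (hG : DifferentiableAt ℝ G q.1) {v : ℂ × ℂ}
    (hv : v ∈ velocities {p | p.2 = G p.1} q) : v.2 = fderiv ℝ G q.1 v.1 := by
  obtain ⟨c, hc0, hcT, hc⟩ := hv
  obtain ⟨h1, h2⟩ := hasDerivAt_fst_snd hc
  have hG' : HasFDerivAt G (fderiv ℝ G q.1) ((fun t => (c t).1) 0) := by
    simpa [hc0] using hG.hasFDerivAt
  refine h2.unique ((hG'.comp_hasDerivAt (0 : ℝ) h1).congr_of_eventuallyEq ?_)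
  filter_upwards [hcT] with t ht using ht

/-- If `v` and `iv` are tangent, the differential of `G` commutes with `i` at `v.1`, so its
antilinear part `conj v.1 * dbar G q.1` vanishes. -/
theorem eq_zero_of_mem_velocities_graph {G : ℂ → ℂ} {q v : ℂ × ℂ}
    (hG : DifferentiableAt ℝ G q.1) (hne : dbar G q.1 ≠ 0)
    (hv : v ∈ velocities {p | p.2 = G p.1} q)
    (hiv : Complex.I • v ∈ velocities {p | p.2 = G p.1} q) : v = 0 := by
  have h1 := velocities_graph hG hv
  have h2 := velocities_graph hG hiv
  set L := fderiv ℝ G q.1 with hL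
  have hlin : ∀ w : ℂ, L w = w.re * L 1 + w.im * L Complex.I := by
    intro w
    have : w = w.re • (1 : ℂ) + w.im • Complex.I := by simp
    conv_lhs => rw [this, map_add, map_smul, map_smul]
    simp
  simp only [Prod.smul_fst, Prod.smul_snd, smul_eq_mul] at h2
  rw [h1, hlin, hlin (Complex.I * v.1)] at h2
  have h3 : conj v.1 * dbar G q.1 = 0 := by
    rw [dbar, ← hL]
    have hc : conj v.1 = v.1.re - v.1.im * Complex.I := by
      apply Complex.ext <;> simp
    rw [hc]
    simp only [Complex.mul_re, Complex.I_re, zero_mul, Complex.I_im, one_mul, zero_sub,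
      Complex.mul_im, zero_add] at h2
    push_cast at h2
    linear_combination (-Complex.I / 2) * h2 + v.1.re * L 1 / 2 * Complex.I_sq
  have h4 : v.1 = 0 := by simpa [hne] using h3
  refine Prod.ext h4 ?_
  rw [h1, h4, map_zero]
  rfl

/-- The first two relations differentiate `Im (ξ²η) = 0` and `|η|² = Q(ξ²η)`. At `ξ = 0` the
differential of `ξ²η` vanishes, and the third relation comes from second order: `(ξ/t)² η` is real
and nonnegative, and tends to `v.1² * q.2`. -/
theorem velocities_modelCrossCap {q v : ℂ × ℂ} (hv : v ∈ velocities (modelCrossCap δ) q) :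
    (2 * q.1 * q.2 * v.1 + q.1 ^ 2 * v.2).im = 0 ∧
      (2 * (conj q.2 * v.2).re =
        deriv (profile δ) (q.1 ^ 2 * q.2).re * (2 * q.1 * q.2 * v.1 + q.1 ^ 2 * v.2).re) ∧
      (q.1 = 0 → 0 ≤ (v.1 ^ 2 * q.2).re ∧ (v.1 ^ 2 * q.2).im = 0) := by
  obtain ⟨c, hc0, hcT, hc⟩ := hv
  obtain ⟨h1, h2⟩ := hasDerivAt_fst_snd hc
  have h10 : (c 0).1 = q.1 := by rw [hc0]
  have h20 : (c 0).2 = q.2 := by rw [hc0]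
  have hY : HasDerivAt (fun t => (c t).1 ^ 2 * (c t).2)
      (2 * q.1 * q.2 * v.1 + q.1 ^ 2 * v.2) 0 := by
    refine ((h1.pow 2).mul h2).congr_deriv ?_
    simp only [h10, h20, Pi.pow_apply]
    ring
  have hYre := (Complex.reCLM.hasFDerivAt).comp_hasDerivAt (0 : ℝ) hY
  have hYim := (Complex.imCLM.hasFDerivAt).comp_hasDerivAt (0 : ℝ) hY
  refine ⟨?_, ?_, ?_⟩
  · refine hYim.unique ((hasDerivAt_const (0 : ℝ) (0 : ℝ)).congr_of_eventuallyEq ?_)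
    filter_upwards [hcT] with t ht
    obtain ⟨y, -, hy, -⟩ := ht
    simp [hy]
  · have hN : HasDerivAt (fun t => ‖(c t).2‖ ^ 2) (2 * (conj q.2 * v.2).re) 0 := by
      have := h2.norm_sq
      rw [h20] at this
      refine this.congr_deriv ?_
      simp [Complex.inner]
      ring
    have hP : HasDerivAt (fun t => profile δ ((c t).1 ^ 2 * (c t).2).re)
        (deriv (profile δ) (q.1 ^ 2 * q.2).re *
          (2 * q.1 * q.2 * v.1 + q.1 ^ 2 * v.2).re) 0 := by
      have hd : HasDerivAt (profile δ) (deriv (profile δ) (q.1 ^ 2 * q.2).re)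
          ((c 0).1 ^ 2 * (c 0).2).re := by
        rw [h10, h20]
        exact (contDiff_profile.contDiffAt.differentiableAt (by simp)).hasDerivAt
      exact hd.comp (0 : ℝ) hYre
    refine hN.unique (hP.congr_of_eventuallyEq ?_)
    filter_upwards [hcT] with t ht
    obtain ⟨y, -, hy, hy'⟩ := ht
    rw [hy', hy, Complex.ofReal_re]
  · intro hq
    have hslope : Tendsto (fun t : ℝ => ((t : ℂ)⁻¹ * (c t).1) ^ 2 * (c t).2) (𝓝[≠] 0)
        (𝓝 (v.1 ^ 2 * q.2)) := by
      refine Tendsto.mul (Tendsto.pow ?_ 2) ?_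
      · have := hasDerivAt_iff_tendsto_slope.1 h1
        refine this.congr fun t => ?_
        simp [slope, h10, hq]
      · rw [← h20]
        exact h2.continuousAt.tendsto.mono_left nhdsWithin_le_nhds
    have hreal : ∀ᶠ t : ℝ in 𝓝[≠] 0, ∃ y : ℝ, 0 ≤ y ∧
        ((t : ℂ)⁻¹ * (c t).1) ^ 2 * (c t).2 = y := by
      filter_upwards [hcT.filter_mono nhdsWithin_le_nhds] with t ht
      obtain ⟨y, hy0, hy, -⟩ := ht
      refine ⟨t⁻¹ ^ 2 * y, by positivity, ?_⟩
      rw [mul_pow, mul_assoc, hy]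
      push_cast
      rfl
    constructor
    · refine ge_of_tendsto ((Complex.continuous_re.tendsto _).comp hslope) ?_
      filter_upwards [hreal] with t ht
      obtain ⟨y, hy0, hy⟩ := ht
      simpa [hy] using hy0
    · refine tendsto_nhds_unique ((Complex.continuous_im.tendsto _).comp hslope)
        (tendsto_const_nhds.congr' ?_)
      filter_upwards [hreal] with t ht
      obtain ⟨y, hy0, hy⟩ := ht
      simp [hy]

/-- Each real linear relation for both `v` and `iv` becomes a complex one: the differential of `ξ²η`
kills `v`, then `v.2 = 0`, and so `v.1 = 0` if `ξ ≠ 0`. If `ξ = 0`, both `v.1² * q.2` and its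
negative are real and nonnegative. -/
theorem eq_zero_of_mem_velocities_modelCrossCap (hδ : 0 < δ) {q v : ℂ × ℂ}
    (hq : q ∈ modelCrossCap δ) (hv : v ∈ velocities (modelCrossCap δ) q)
    (hiv : Complex.I • v ∈ velocities (modelCrossCap δ) q) : v = 0 := by
  have hq2 : q.2 ≠ 0 := snd_ne_zero_of_mem_modelCrossCap hδ hq
  obtain ⟨h1, h2, h3⟩ := velocities_modelCrossCap hv
  obtain ⟨h1', h2', h3'⟩ := velocities_modelCrossCap hiv
  set m := 2 * q.1 * q.2 * v.1 + q.1 ^ 2 * v.2 with hm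
  have hm' : 2 * q.1 * q.2 * (Complex.I • v).1 + q.1 ^ 2 * (Complex.I • v).2 = Complex.I * m := by
    simp only [Prod.smul_fst, Prod.smul_snd, smul_eq_mul, hm]
    ring
  rw [hm'] at h1' h2'
  have hmre : m.re = 0 := by simpa using h1'
  have hm0 : m = 0 := Complex.ext hmre h1
  have hb : conj q.2 * v.2 = 0 := by
    apply Complex.ext
    · rw [hm0] at h2
      simp only [Complex.zero_re, mul_zero] at h2
      rw [Complex.zero_re]
      linarith
    · rw [hm0] at h2'
      have : conj q.2 * (Complex.I • v).2 = Complex.I * (conj q.2 * v.2) := by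
        simp only [Prod.smul_snd, smul_eq_mul]
        ring
      rw [this] at h2'
      simp only [mul_zero, Complex.zero_re, Complex.I_mul_re] at h2'
      rw [Complex.zero_im]
      linarith
  have hv2 : v.2 = 0 := by simpa [hq2] using hb
  refine Prod.ext ?_ hv2
  by_cases hq1 : q.1 = 0
  · have h4 : (Complex.I • v).1 ^ 2 * q.2 = -(v.1 ^ 2 * q.2) := by
      simp only [Prod.smul_fst, smul_eq_mul, mul_pow, Complex.I_sq]
      ring
    have h5 := h3 hq1
    have h6 := h3' hq1
    rw [h4, Complex.neg_re] at h6
    have h7 : v.1 ^ 2 * q.2 = 0 := Complex.ext (by rw [Complex.zero_re]; linarith [h5.1, h6.1]) h5.2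
    simpa [hq2] using h7
  · rw [hv2, mul_zero, add_zero] at hm
    rw [hm0] at hm
    simpa [hq1, hq2] using hm.symm

end Model

/-! ### Parametrization of the totally real cross-cap -/

section Parametrization

variable {δ : ℝ}

/-- A parametrization of the model cross-cap by `ℝ × S¹`, up to the identification of `(s, u)` with
`(-s, -u)`. -/
def stripMap (δ s : ℝ) (u : ℂ) : ℂ × ℂ :=
  ((s / √√(profile δ (s ^ 2)) : ℝ) * u, (√(profile δ (s ^ 2)) : ℝ) * conj u ^ 2)

theorem stripMap_neg (δ s : ℝ) (u : ℂ) : stripMap δ (-s) (-u) = stripMap δ s u := by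
  simp [stripMap, neg_div]

theorem conj_mul_self_of_norm {u : ℂ} (hu : ‖u‖ = 1) : u * conj u = 1 := by
  rw [Complex.mul_conj, Complex.normSq_eq_norm_sq, hu]
  simp

theorem continuous_stripMap (hδ : 0 < δ) : Continuous fun p : ℝ × ℂ => stripMap δ p.1 p.2 := by
  have hQ : Continuous fun p : ℝ × ℂ => √(profile δ (p.1 ^ 2)) :=
    (contDiff_profile.continuous.comp (continuous_fst.pow 2)).sqrt
  have h1 : Continuous fun p : ℝ × ℂ => p.1 / √√(profile δ (p.1 ^ 2)) :=
    continuous_fst.div hQ.sqrt fun p =>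
      (Real.sqrt_pos.2 (Real.sqrt_pos.2 (profile_pos hδ (sq_nonneg p.1)))).ne'
  exact ((Complex.continuous_ofReal.comp h1).mul continuous_snd).prodMk
    ((Complex.continuous_ofReal.comp hQ).mul ((Complex.continuous_conj.comp continuous_snd).pow 2))

theorem stripMap_sq_mul (hδ : 0 < δ) (s : ℝ) {u : ℂ} (hu : ‖u‖ = 1) :
    (stripMap δ s u).1 ^ 2 * (stripMap δ s u).2 = ((s ^ 2 : ℝ) : ℂ) := by
  set a := √√(profile δ (s ^ 2)) with ha
  have hpos : 0 < √(profile δ (s ^ 2)) := Real.sqrt_pos.2 (profile_pos hδ (sq_nonneg s))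
  have ha0 : (a : ℂ) ≠ 0 := by exact_mod_cast (Real.sqrt_pos.2 hpos).ne'
  have ha2 : √(profile δ (s ^ 2)) = a ^ 2 := (Real.sq_sqrt hpos.le).symm
  have huu := conj_mul_self_of_norm hu
  simp only [stripMap, ← ha]
  rw [ha2]
  push_cast
  rw [mul_pow, div_pow, show (s : ℂ) ^ 2 / a ^ 2 * u ^ 2 * (a ^ 2 * conj u ^ 2) =
    s ^ 2 / a ^ 2 * a ^ 2 * (u * conj u) ^ 2 by ring, huu,
    div_mul_cancel₀ _ (pow_ne_zero 2 ha0), one_pow, mul_one]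

theorem norm_stripMap_snd (s : ℝ) {u : ℂ} (hu : ‖u‖ = 1) :
    ‖(stripMap δ s u).2‖ = √(profile δ (s ^ 2)) := by
  simp [stripMap, hu, abs_of_nonneg (Real.sqrt_nonneg _)]

theorem stripMap_mem (hδ : 0 < δ) (s : ℝ) {u : ℂ} (hu : ‖u‖ = 1) :
    stripMap δ s u ∈ modelCrossCap δ :=
  ⟨s ^ 2, sq_nonneg s, stripMap_sq_mul hδ s hu, by
    rw [norm_stripMap_snd s hu, Real.sq_sqrt (profile_pos hδ (sq_nonneg s)).le]⟩

theorem stripMap_injective (hδ : 0 < δ) {s s' : ℝ} {u u' : ℂ} (hu : ‖u‖ = 1) (hu' : ‖u'‖ = 1)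
    (h : stripMap δ s u = stripMap δ s' u') : s' = s ∧ u' = u ∨ s' = -s ∧ u' = -u := by
  have hs : s ^ 2 = s' ^ 2 := by
    have h1 := stripMap_sq_mul hδ s hu
    rw [h, stripMap_sq_mul hδ s' hu'] at h1
    exact_mod_cast h1.symm
  have hpos : 0 < √(profile δ (s' ^ 2)) := Real.sqrt_pos.2 (profile_pos hδ (sq_nonneg s'))
  have hpos' := Real.sqrt_pos.2 hpos
  simp only [stripMap, Prod.mk.injEq] at h
  rw [hs] at h
  have h2 : conj u ^ 2 = conj u' ^ 2 := mul_left_cancel₀ (by exact_mod_cast hpos.ne') h.2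
  have h3 : (s : ℂ) * u = s' * u' := by
    have := h.1
    push_cast at this
    have hne : ((√√(profile δ (s' ^ 2)) : ℝ) : ℂ) ≠ 0 := by exact_mod_cast hpos'.ne'
    field_simp at this
    exact this
  have hu0 : u ≠ 0 := norm_ne_zero_iff.1 (by rw [hu]; exact one_ne_zero)
  rw [← map_pow, ← map_pow] at h2
  rcases sq_eq_sq_iff_eq_or_eq_neg.1 ((starRingEnd ℂ).injective h2).symm with rfl | rfl
  · exact Or.inl ⟨by exact_mod_cast (mul_right_cancel₀ hu0 h3).symm, rfl⟩
  · refine Or.inr ⟨?_, rfl⟩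
    have : (s : ℂ) * u = (-s' : ℝ) * u := by rw [h3]; push_cast; ring
    have := mul_right_cancel₀ hu0 this
    have : s = -s' := by exact_mod_cast this
    rw [this, neg_neg]

theorem exists_stripMap_eq (hδ : 0 < δ) {p : ℂ × ℂ} (hp : p ∈ modelCrossCap δ) :
    ∃ s u, ‖u‖ = 1 ∧ stripMap δ s u = p := by
  have hp2 : p.2 ≠ 0 := snd_ne_zero_of_mem_modelCrossCap hδ hp
  obtain ⟨y, hy, h1, h2⟩ := hp
  obtain ⟨κ, hκ'⟩ := IsAlgClosed.exists_pow_nat_eq p.2 two_pos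
  have hκ : p.2 = κ ^ 2 := hκ'.symm
  have hκ0 : κ ≠ 0 := by
    rintro rfl
    exact hp2 (by rw [hκ]; simp)
  obtain ⟨h3, h4⟩ := im_eq_zero_of_sq_eq (Z := p.1 * κ) hy (by rw [mul_pow, ← hκ, h1])
  have hκn : √√(profile δ y) = ‖κ‖ := by
    rw [← h2, Real.sqrt_sq (norm_nonneg _), hκ, norm_pow, Real.sqrt_sq (norm_nonneg _)]
  have hκn2 : √(profile δ y) = ‖κ‖ ^ 2 := by
    rw [← h2, Real.sqrt_sq (norm_nonneg _), hκ, norm_pow]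
  have hn : (‖κ‖ : ℂ) ≠ 0 := by simpa using hκ0
  have hcc : κ * conj κ = (‖κ‖ : ℂ) ^ 2 := by
    rw [Complex.mul_conj, Complex.normSq_eq_norm_sq]
    push_cast
    rfl
  -- Here `κ` is a square root of `η`. The parameter `s` is the coordinate `Z = ξ√η`, and `u` is the
  -- conjugate phase of `κ`; the other root gives `(-s, -u)`.
  refine ⟨(p.1 * κ).re, conj κ / ‖κ‖, by simp [hκ0], ?_⟩
  have hre : (((p.1 * κ).re : ℝ) : ℂ) = p.1 * κ := Complex.ext rfl (by simpa using h3.symm)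
  simp only [stripMap, h4]
  rw [hκn, hκn2]
  refine Prod.ext ?_ ?_
  · simp only
    push_cast
    rw [hre]
    field_simp
    rw [mul_assoc, hcc]
  · simp only [map_div₀, Complex.conj_conj, Complex.conj_ofReal]
    push_cast
    rw [hκ]
    field_simp

theorem norm_stripMap_fst (s : ℝ) {u : ℂ} (hu : ‖u‖ = 1) :
    ‖(stripMap δ s u).1‖ = |s| / √√(profile δ (s ^ 2)) := by
  simp [stripMap, hu, abs_of_nonneg (Real.sqrt_nonneg _)]

/-- The position of a point of the cross-cap with respect to the circle of radius `ε` is determined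
by its first parameter. -/
theorem norm_stripMap_fst_cases (hδ : 0 < δ) {ε : ℝ} (hε : 0 < ε) (hδε : δ < ε ^ 4) (s : ℝ) {u : ℂ}
    (hu : ‖u‖ = 1) :
    (‖(stripMap δ s u).1‖ ≤ ε ↔ |s| ≤ ε ^ 2) ∧ (‖(stripMap δ s u).1‖ = ε ↔ |s| = ε ^ 2) := by
  have hQ := profile_pos hδ (sq_nonneg s)
  set Q := profile δ (s ^ 2) with hQdef
  set a := √√Q with ha
  have ha0 : 0 < a := Real.sqrt_pos.2 (Real.sqrt_pos.2 hQ)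
  have ha4 : a ^ 4 = Q := by
    rw [show a ^ 4 = (a ^ 2) ^ 2 by ring, ha, Real.sq_sqrt (Real.sqrt_nonneg _),
      Real.sq_sqrt hQ.le]
  have hle : s ^ 2 ≤ Q := le_profile hδ
  -- In this range `s² ≥ ε⁴ > δ`, so the profile is the identity and the first coordinate has norm
  -- `√|s|`. For smaller `|s|` only `s² ≤ Q` is needed.
  have hself : ε ^ 2 ≤ |s| → Q = s ^ 2 := by
    intro h
    refine profile_eq_self hδ ?_
    have := pow_le_pow_left₀ (by positivity) h 2
    rw [sq_abs] at this
    nlinarith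
  have hs4 : |s| ^ 4 = s ^ 2 * s ^ 2 := by
    rw [show |s| ^ 4 = (|s| ^ 2) * (|s| ^ 2) by ring, sq_abs]
  have hεa : (ε * a) ^ 4 = (ε ^ 2) ^ 2 * Q := by rw [mul_pow, ha4]; ring
  have hlt : |s| < ε ^ 2 → |s| < ε * a := by
    intro h
    refine lt_of_pow_lt_pow_left₀ 4 (by positivity) ?_
    have := pow_lt_pow_left₀ h (abs_nonneg s) two_ne_zero
    rw [sq_abs] at this
    rw [hs4, hεa]
    exact (mul_le_mul_of_nonneg_left hle (sq_nonneg s)).trans_lt (mul_lt_mul_of_pos_right this hQ)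
  have hgt : ε ^ 2 < |s| → ε * a < |s| := by
    intro h
    refine lt_of_pow_lt_pow_left₀ 4 (abs_nonneg s) ?_
    have := pow_lt_pow_left₀ h (by positivity) two_ne_zero
    rw [sq_abs] at this
    rw [hs4, hεa, hself h.le]
    have : 0 < s ^ 2 := (by positivity : (0 : ℝ) < (ε ^ 2) ^ 2).trans this
    gcongr
  have heq : |s| = ε ^ 2 → |s| = ε * a := by
    intro h
    refine (pow_left_inj₀ (abs_nonneg s) (by positivity) four_ne_zero).1 ?_
    rw [hs4, hεa, hself h.ge, ← h, sq_abs]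
  rw [norm_stripMap_fst s hu, ← hQdef, ← ha, div_le_iff₀ ha0, div_eq_iff ha0.ne']
  rcases lt_trichotomy |s| (ε ^ 2) with h | h | h
  · have := hlt h
    exact ⟨⟨fun _ => h.le, fun _ => this.le⟩, ⟨fun h' => absurd h' this.ne, fun h' => absurd h' h.ne⟩⟩
  · have := heq h
    exact ⟨⟨fun _ => h.le, fun _ => this.le⟩, ⟨fun _ => h, fun _ => this⟩⟩
  · have := hgt h
    exact ⟨⟨fun h' => absurd h' this.not_ge, fun h' => absurd h' h.not_ge⟩,
      ⟨fun h' => absurd h' this.ne', fun h' => absurd h' h.ne'⟩⟩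

/-- The horizontal direction of a point of the sphere off the polar caps. -/
def horizontalDirection (x : Sphere2) : ℂ :=
  -- The maximum only makes the map continuous at the poles. For height at most `1/2` in absolute
  -- value the horizontal part has norm at least `1/2`.
  (x.1 0 + x.1 1 * Complex.I) / (max ‖(x.1 0 + x.1 1 * Complex.I : ℂ)‖ (1 / 2) : ℝ)

theorem continuous_horizontalDirection : Continuous horizontalDirection := by
  have h : Continuous fun x : Sphere2 => (x.1 0 + x.1 1 * Complex.I : ℂ) := by fun_prop
  refine h.div (Complex.continuous_ofReal.comp (h.norm.max continuous_const)) fun x => ?_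
  have : (0 : ℝ) < max ‖(x.1 0 + x.1 1 * Complex.I : ℂ)‖ (1 / 2) := lt_max_of_lt_right (by norm_num)
  exact_mod_cast this.ne'

theorem horizontalDirection_neg (x : Sphere2) :
    horizontalDirection (-x) = -horizontalDirection x := by
  have h0 : ∀ i, (-x).1 i = -x.1 i := fun _ => rfl
  have : (((-x).1 0 : ℂ) + (-x).1 1 * Complex.I) = -(x.1 0 + x.1 1 * Complex.I) := by
    rw [h0, h0]; push_cast; ring
  rw [horizontalDirection, horizontalDirection, this, norm_neg, neg_div]

theorem sphere_sq_add (x : Sphere2) : x.1 0 ^ 2 + x.1 1 ^ 2 + x.1 2 ^ 2 = 1 := by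
  have h : ‖x.1‖ = 1 := by simp
  have h2 := EuclideanSpace.real_norm_sq_eq x.1
  rw [h, Fin.sum_univ_three] at h2
  linarith

/-- Off the polar caps, the height and the horizontal direction determine a point of the sphere. -/
theorem horizontalDirection_spec {x : Sphere2} (hx : |x.1 2| ≤ 1 / 2) :
    ‖horizontalDirection x‖ = 1 ∧
      (x.1 0 + x.1 1 * Complex.I : ℂ) = (√(1 - x.1 2 ^ 2) : ℝ) * horizontalDirection x := by
  have hsq : x.1 2 ^ 2 ≤ 1 / 4 := by
    have := pow_le_pow_left₀ (abs_nonneg _) hx 2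
    rw [sq_abs] at this
    linarith
  have hn : ‖(x.1 0 + x.1 1 * Complex.I : ℂ)‖ = √(1 - x.1 2 ^ 2) := by
    rw [Complex.norm_add_mul_I]
    congr 1
    linarith [sphere_sq_add x]
  have hge : 1 / 2 ≤ √(1 - x.1 2 ^ 2) := Real.le_sqrt_of_sq_le (by linarith)
  have hpos : √(1 - x.1 2 ^ 2) ≠ 0 := by linarith
  rw [horizontalDirection, hn, max_eq_left hge]
  refine ⟨?_, ?_⟩
  · rw [norm_div, hn, Complex.norm_real, Real.norm_of_nonneg (Real.sqrt_nonneg _), div_self hpos]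
  · rw [mul_div_cancel₀ _ (by exact_mod_cast hpos)]

theorem exists_sphere_point {z : ℝ} (hz : |z| ≤ 1 / 2) {u : ℂ} (hu : ‖u‖ = 1) :
    ∃ x : Sphere2, x.1 2 = z ∧ horizontalDirection x = u := by
  have hsq : z ^ 2 ≤ 1 / 4 := by
    have := pow_le_pow_left₀ (abs_nonneg _) hz 2
    rw [sq_abs] at this
    linarith
  set w := √(1 - z ^ 2) with hw
  have hw2 : w ^ 2 = 1 - z ^ 2 := Real.sq_sqrt (by linarith)
  have hw0 : 0 < w := Real.sqrt_pos.2 (by linarith)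
  have hu2 : u.re ^ 2 + u.im ^ 2 = 1 := by
    have := Complex.sq_norm u
    rw [hu, Complex.normSq_apply] at this
    linarith
  have hmem : !₂[w * u.re, w * u.im, z] ∈ Metric.sphere (0 : EuclideanSpace ℝ (Fin 3)) 1 := by
    rw [mem_sphere_zero_iff_norm, ← sq_eq_sq₀ (norm_nonneg _) zero_le_one,
      EuclideanSpace.real_norm_sq_eq, Fin.sum_univ_three]
    simp
    linear_combination w ^ 2 * hu2 + hw2
  refine ⟨⟨_, hmem⟩, rfl, ?_⟩
  obtain ⟨-, h⟩ := horizontalDirection_spec (x := ⟨_, hmem⟩) hz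
  have h' : (w : ℂ) * u = w * horizontalDirection ⟨_, hmem⟩ := by
    refine Eq.trans ?_ h
    show (w : ℂ) * u = ((w * u.re : ℝ) : ℂ) + ((w * u.im : ℝ) : ℂ) * Complex.I
    conv_lhs => rw [← Complex.re_add_im u]
    push_cast
    ring
  exact (mul_left_cancel₀ (by exact_mod_cast hw0.ne') h').symm

theorem sphere_ext {x x' : Sphere2} (h2 : x.1 2 = x'.1 2)
    (h : (x.1 0 + x.1 1 * Complex.I : ℂ) = x'.1 0 + x'.1 1 * Complex.I) : x = x' := by
  have hre := congrArg Complex.re h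
  have him := congrArg Complex.im h
  simp at hre him
  refine Subtype.ext (PiLp.ext fun i => ?_)
  fin_cases i
  · exact hre
  · exact him
  · exact h2

theorem toRP2_mem_crossCap_iff {x : Sphere2} : toRP2 x ∈ crossCap ↔ |x.1 2| ≤ 1 / 2 := by
  have hneg : (-x).1 2 = -(x.1 2) := rfl
  constructor
  · intro h
    by_contra! hlt
    rcases lt_abs.1 hlt with h' | h'
    · exact h ⟨x, h', rfl⟩
    · exact h ⟨-x, by rw [mem_ofPred_eq, hneg]; exact h', Quotient.sound (Or.inr rfl)⟩
  · rintro h ⟨y, hy, hxy⟩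
    have hy' : 1 / 2 < y.1 2 := hy
    rw [abs_le] at h
    rcases Quotient.exact hxy with rfl | rfl
    · linarith
    · rw [hneg] at hy'
      linarith

/-- The model cross-cap, sheared by `H`. -/
def shearedCrossCap (δ : ℝ) (H : ℂ → ℂ) : Set (ℂ × ℂ) :=
  {p | (p.1, p.2 - H p.1) ∈ modelCrossCap δ}

/-- Height `z` and horizontal direction `u` on the sphere give the strip parameters `(2ε²z, u)`. The
antipodal map becomes `(s, u) ↦ (-s, -u)`, which is the only identification made by `stripMap`, and
`|z| ≤ 1/2` corresponds to `‖ξ‖ ≤ ε`. -/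
theorem exists_crossCap_parametrization (hδ : 0 < δ) {ε : ℝ} (hε : 0 < ε) (hδε : δ < ε ^ 4)
    {H : ℂ → ℂ} (hH : Continuous H) :
    ∃ k : RP2 → ℂ × ℂ, Continuous k ∧ InjOn k crossCap ∧
      k '' crossCap = {p | p ∈ shearedCrossCap δ H ∧ ‖p.1‖ ≤ ε} ∧
      k '' crossCapBoundary = {p | p ∈ shearedCrossCap δ H ∧ ‖p.1‖ = ε} := by
  let f : Sphere2 → ℂ × ℂ := fun x =>
    shear H hH (stripMap δ (2 * ε ^ 2 * x.1 2) (horizontalDirection x))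
  have hf : Continuous f := by
    refine (shear H hH).continuous.comp ((continuous_stripMap hδ).comp
      (Continuous.prodMk ?_ continuous_horizontalDirection))
    fun_prop
  have hfneg : ∀ x, f (-x) = f x := by
    intro x
    have h2 : 2 * ε ^ 2 * (-x).1 2 = -(2 * ε ^ 2 * x.1 2) := by
      rw [show (-x).1 2 = -(x.1 2) from rfl]; ring
    simp only [f]
    rw [h2, horizontalDirection_neg, stripMap_neg]
  have hrel : ∀ a b : Sphere2, antipodalSetoid.r a b → f a = f b := by
    rintro a b (rfl | rfl)
    · rfl
    · exact hfneg b
  have hε2 : 0 < 2 * ε ^ 2 := by positivity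
  have hheight : ∀ z : ℝ, |z| ≤ 1 / 2 ↔ |2 * ε ^ 2 * z| ≤ ε ^ 2 := by
    intro z
    rw [abs_mul, abs_of_pos hε2, show ε ^ 2 = 2 * ε ^ 2 * (1 / 2) by ring]
    rw [show 2 * (2 * ε ^ 2 * (1 / 2)) = 2 * ε ^ 2 by ring, mul_le_mul_iff_right₀ hε2]
  have hheight' : ∀ z : ℝ, |z| = 1 / 2 ↔ |2 * ε ^ 2 * z| = ε ^ 2 := by
    intro z
    rw [abs_mul, abs_of_pos hε2]
    constructor
    · intro h; rw [h]; ring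
    · intro h
      refine mul_left_cancel₀ hε2.ne' (h.trans ?_)
      ring
  have hmem : ∀ x : Sphere2, |x.1 2| ≤ 1 / 2 → f x ∈ shearedCrossCap δ H ∧ ‖(f x).1‖ ≤ ε ∧
      (|x.1 2| = 1 / 2 → ‖(f x).1‖ = ε) := by
    intro x hx
    have hu := (horizontalDirection_spec hx).1
    have hc := norm_stripMap_fst_cases hδ hε hδε (2 * ε ^ 2 * x.1 2) hu
    refine ⟨?_, hc.1.2 ((hheight _).1 hx), fun h => hc.2.2 ((hheight' _).1 h)⟩
    have := stripMap_mem hδ (2 * ε ^ 2 * x.1 2) hu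
    simpa [shearedCrossCap, f, shear] using this
  have hsurj : ∀ p ∈ shearedCrossCap δ H, ‖p.1‖ ≤ ε → ∃ x : Sphere2, |x.1 2| ≤ 1 / 2 ∧ f x = p ∧
      (‖p.1‖ = ε → |x.1 2| = 1 / 2) := by
    intro p hp hpε
    obtain ⟨s, u, hu, hsu⟩ := exists_stripMap_eq hδ hp
    have hc := norm_stripMap_fst_cases hδ hε hδε s hu
    rw [hsu] at hc
    have hs : 2 * ε ^ 2 * (s / (2 * ε ^ 2)) = s := mul_div_cancel₀ _ hε2.ne'
    have hz : |s / (2 * ε ^ 2)| ≤ 1 / 2 := by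
      rw [hheight, hs]
      exact hc.1.1 hpε
    obtain ⟨x, hx2, hxu⟩ := exists_sphere_point hz hu
    refine ⟨x, by rw [hx2]; exact hz, ?_, fun h => ?_⟩
    · simp only [f]
      rw [hx2, hxu, hs, hsu]
      simp [shear]
    · rw [hx2, hheight', hs]
      exact hc.2.1 h
  refine ⟨Quotient.lift f hrel, hf.quotient_lift hrel, ?_, ?_, ?_⟩
  · rintro ⟨x⟩ hx ⟨x'⟩ hx' hxx
    have h1 : |x.1 2| ≤ 1 / 2 := toRP2_mem_crossCap_iff.1 hx
    have h1' : |x'.1 2| ≤ 1 / 2 := toRP2_mem_crossCap_iff.1 hx'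
    obtain ⟨hu, hv⟩ := horizontalDirection_spec h1
    obtain ⟨hu', hv'⟩ := horizontalDirection_spec h1'
    have h2 := stripMap_injective hδ hu hu' ((shear H hH).injective hxx)
    have hn : ∀ i, (-x).1 i = -x.1 i := fun _ => rfl
    rcases h2 with ⟨h3, h4⟩ | ⟨h3, h4⟩
    · have h5 : x'.1 2 = x.1 2 := mul_left_cancel₀ hε2.ne' h3
      refine congrArg toRP2 (sphere_ext h5.symm ?_)
      rw [hv, hv', h4, h5]
    · have h5 : x'.1 2 = -x.1 2 := mul_left_cancel₀ hε2.ne' (h3.trans (by ring))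
      refine Quotient.sound (Or.inr ?_)
      rw [eq_comm, neg_eq_iff_eq_neg]
      refine sphere_ext (h5.trans (hn 2).symm) ?_
      rw [hv', h4, h5, neg_sq, mul_neg, ← hv, hn, hn]
      push_cast
      ring
  · ext p
    constructor
    · rintro ⟨⟨x⟩, hx, rfl⟩
      have h := hmem x (toRP2_mem_crossCap_iff.1 hx)
      exact ⟨h.1, h.2.1⟩
    · rintro ⟨hp, hpε⟩
      obtain ⟨x, hx, rfl, -⟩ := hsurj p hp hpε
      exact ⟨toRP2 x, toRP2_mem_crossCap_iff.2 hx, rfl⟩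
  · ext p
    constructor
    · rintro ⟨_, ⟨x, hx, rfl⟩, rfl⟩
      have hx' : |x.1 2| = 1 / 2 := by
        rw [show x.1 2 = 1 / 2 from hx]
        norm_num
      have h := hmem x hx'.le
      exact ⟨h.1, h.2.2 hx'⟩
    · rintro ⟨hp, hpε⟩
      obtain ⟨x, hx, rfl, hx'⟩ := hsurj p hp hpε.le
      -- The boundary circle is the image of the parallel of height `+1/2` only; a point of height
      -- `-1/2` is replaced by its antipode.
      rcases eq_or_eq_neg_of_abs_eq (hx' hpε) with h | h
      · exact ⟨toRP2 x, ⟨x, h, rfl⟩, rfl⟩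
      · refine ⟨toRP2 (-x), ⟨-x, ?_, rfl⟩, hfneg x⟩
        show -(x.1 2) = 1 / 2
        rw [h, neg_neg]

end Parametrization

/-! ### The local totally real blow-up -/

section LocalBlowup

theorem exists_flattening_shearedCrossCap {δ : ℝ} (hδ : 0 < δ) {H : ℂ → ℂ} (hH : ContDiff ℝ ∞ H)
    {q : ℂ × ℂ} (hq : q ∈ shearedCrossCap δ H) :
    ∃ ψ ∈ contDiffGroupoid ∞ 𝓘(ℝ, ℂ × ℂ), q ∈ ψ.source ∧
      ∀ x ∈ ψ.source, x ∈ shearedCrossCap δ H ↔ (ψ x).2 = 0 := by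
  obtain ⟨ψ, hψ, hqψ, hψx⟩ := exists_flattening_modelCrossCap hδ hq
  refine ⟨(shear H hH.continuous).symm.toOpenPartialHomeomorph.trans ψ,
    StructureGroupoid.trans _ (StructureGroupoid.symm _ (shear_mem_contDiffGroupoid hH)) hψ, ?_, ?_⟩
  · simpa [shear] using hqψ
  · intro x hx
    have hx' : (x.1, x.2 - H x.1) ∈ ψ.source := by simpa [shear] using hx
    exact hψx _ hx'

theorem ne_zero_of_hasWindingNumber {g : ℂ → ℂ} {r : ℝ} {k : ℤ}
    (h : HasWindingNumber (fun t => g (r * Complex.exp (t * Complex.I))) k) {ξ : ℂ} (hξ : ‖ξ‖ = r) :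
    g ξ ≠ 0 := by
  obtain ⟨l, -, hl, -⟩ := h
  obtain ⟨t, ht, hξt⟩ : ∃ t ∈ Icc 0 (2 * Real.pi), (r * Complex.exp (t * Complex.I) : ℂ) = ξ := by
    have hpi := Real.pi_pos
    have harg := Complex.norm_mul_exp_arg_mul_I ξ
    rw [hξ] at harg
    rcases le_or_gt 0 ξ.arg with h0 | h0
    · exact ⟨ξ.arg, ⟨h0, by linarith [Complex.arg_le_pi ξ]⟩, harg⟩
    · refine ⟨ξ.arg + 2 * Real.pi, ⟨by linarith [Complex.neg_pi_lt_arg ξ], by linarith⟩, ?_⟩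
      push_cast
      rw [add_mul, Complex.exp_add, Complex.exp_two_pi_mul_I, mul_one, harg]
  have := hl t ht
  simp only [hξt] at this
  rw [this]
  exact Complex.exp_ne_zero _

/-- The graph of a function with a hyperbolic complex point at `0` can be replaced near `0` by a
totally real cross-cap `T`. -/
theorem exists_local_crossCap {F : ℂ → ℂ} (hF : ContDiff ℝ ∞ F) (hF0 : F 0 = 0)
    (hw : ∀ᶠ r : ℝ in 𝓝[>] 0,
      HasWindingNumber (fun t => dbar F (r * Complex.exp (t * Complex.I))) (-1))
    {R₀ : ℝ} (hR₀ : 0 < R₀) :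
    ∃ (T : Set (ℂ × ℂ)) (R ε : ℝ), 0 < ε ∧ ε < R ∧ R ≤ R₀ ∧
      (∀ p ∈ T, ‖p.1‖ < R → ‖p.2‖ < R₀) ∧ (∀ ξ, ‖ξ‖ < R → ‖F ξ‖ < R₀) ∧
      (∀ p : ℂ × ℂ, ε ≤ ‖p.1‖ → (p ∈ T ↔ p.2 = F p.1)) ∧
      (∀ q ∈ T, ∃ ψ ∈ contDiffGroupoid ∞ 𝓘(ℝ, ℂ × ℂ), q ∈ ψ.source ∧
        ∀ x ∈ ψ.source, x ∈ T ↔ (ψ x).2 = 0) ∧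
      (∀ q ∈ T, ‖q.1‖ < R → ∀ v ∈ velocities T q, Complex.I • v ∈ velocities T q → v = 0) ∧
      ∃ k : RP2 → ℂ × ℂ, Continuous k ∧ InjOn k crossCap ∧
        k '' crossCap = {p | p ∈ T ∧ ‖p.1‖ ≤ ε} ∧
        k '' crossCapBoundary = {p | p ∈ T ∧ ‖p.1‖ = ε} := by
  set ρ := R₀ / 4 with hρdef
  have hρ : 0 < ρ := by positivity
  obtain ⟨R, hR, hRR₀, hRρ, hFR, hwR⟩ : ∃ R > 0, R ≤ R₀ ∧ R ^ 2 ≤ ρ ∧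
      (∀ ξ, ‖ξ‖ < R → ‖F ξ‖ ≤ ρ) ∧ ∀ r, 0 < r → r < R →
      HasWindingNumber (fun t => dbar F (r * Complex.exp (t * Complex.I))) (-1) := by
    obtain ⟨R₁, hR₁, h1⟩ := (mem_nhdsGT_iff_exists_Ioo_subset' (one_pos)).1 hw
    have hFc : ∀ᶠ ξ in 𝓝 (0 : ℂ), ‖F ξ‖ < ρ :=
      hF.continuous.norm.continuousAt.eventually_lt continuousAt_const (by simpa [hF0] using hρ)
    obtain ⟨R₂, hR₂, h2⟩ := Metric.eventually_nhds_iff.1 hFc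
    have hR₁' : 0 < R₁ := hR₁
    refine ⟨min (min R₁ R₂) (min R₀ (min 1 ρ)), by positivity, ?_, ?_, fun ξ hξ => ?_,
      fun r hr hrR => ?_⟩
    · exact (min_le_right _ _).trans (min_le_left _ _)
    · have hle1 : min (min R₁ R₂) (min R₀ (min 1 ρ)) ≤ 1 :=
        (min_le_right _ _).trans ((min_le_right _ _).trans (min_le_left _ _))
      have hleρ : min (min R₁ R₂) (min R₀ (min 1 ρ)) ≤ ρ :=
        (min_le_right _ _).trans ((min_le_right _ _).trans (min_le_right _ _))
      have hpos : 0 < min (min R₁ R₂) (min R₀ (min 1 ρ)) := by positivity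
      nlinarith
    · refine (h2 ?_).le
      rw [dist_zero_right]
      exact hξ.trans_le ((min_le_left _ _).trans (min_le_right _ _))
    · exact h1 ⟨hr, hrR.trans_le ((min_le_left _ _).trans (min_le_left _ _))⟩
  have hne : ∀ ξ, ξ ≠ 0 → ‖ξ‖ < R → dbar F ξ ≠ 0 := fun ξ hξ hξR =>
    ne_zero_of_hasWindingNumber (hwR ‖ξ‖ (norm_pos_iff.2 hξ) hξR) rfl
  obtain ⟨G, hG, δ', ε, hδ', hδε, hεR, hG₁, hG₂, hGne, hGρ⟩ := exists_eq_conj_sq_near_zero hF hne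
    (half_pos hR) (half_lt_self hR) (hwR _ (half_pos hR) (half_lt_self hR)) hFR hRρ
  have hε : 0 < ε := hδ'.trans hδε
  -- The model differs from `η = ξ̄²` only where `‖ξ‖⁴ < δ`, well inside the disc `‖ξ‖ ≤ δ'` on
  -- which `G` is `ξ̄²`. The shear by `H` below is thus trivial where the cross-cap is, and
  -- elsewhere it turns the graph of `ξ̄²` into that of `G`.
  set δ := δ' ^ 4 / 2 with hδdef
  have hδ : 0 < δ := by positivity
  have hδδ' : δ < δ' ^ 4 := half_lt_self (by positivity)
  have hδ'ε : δ' ^ 4 < ε ^ 4 := pow_lt_pow_left₀ hδε hδ'.le four_ne_zero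
  have hδρ : 2 * δ ≤ ρ ^ 2 := by
    calc 2 * δ = (δ' ^ 2) ^ 2 := by rw [hδdef]; ring
      _ ≤ (R ^ 2) ^ 2 := by
          have := hδε.trans hεR
          gcongr
      _ ≤ ρ ^ 2 := by gcongr
  let H : ℂ → ℂ := fun ξ => G ξ - conj ξ ^ 2
  have hH : ContDiff ℝ ∞ H := hG.sub (contDiff_conj.pow 2)
  have hH0 : ∀ ξ, ‖ξ‖ ≤ δ' → H ξ = 0 := fun ξ hξ => by simp [H, hG₁ ξ hξ]
  have hgraph : ∀ p : ℂ × ℂ, δ ≤ ‖p.1‖ ^ 4 → (p ∈ shearedCrossCap δ H ↔ p.2 = G p.1) := by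
    intro p hp
    refine (mem_modelCrossCap_iff hδ hp).trans ?_
    simp only [H]
    constructor
    · intro h; linear_combination h
    · intro h; linear_combination h
  have hmodel : ∀ p : ℂ × ℂ, ‖p.1‖ ≤ δ' → (p ∈ shearedCrossCap δ H ↔ p ∈ modelCrossCap δ) := by
    intro p hp
    simp [shearedCrossCap, hH0 _ hp]
  have hsmall : ∀ {ξ : ℂ}, ‖ξ‖ ^ 4 ≤ δ → ‖ξ‖ < δ' := fun h =>
    lt_of_pow_lt_pow_left₀ 4 hδ'.le (h.trans_lt hδδ')
  refine ⟨shearedCrossCap δ H, R, ε, hε, hεR, hRR₀, fun p hp hpR => ?_, fun ξ hξ => ?_,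
    fun p hp => ?_, fun q hq => exists_flattening_shearedCrossCap hδ hH hq,
    fun q hq hqR v hv hiv => ?_,
    exists_crossCap_parametrization hδ hε (hδδ'.trans hδ'ε) hH.continuous⟩
  · rcases le_total δ (‖p.1‖ ^ 4) with h | h
    · rw [(hgraph p h).1 hp]
      linarith [hGρ p.1 hpR]
    · have h1 := norm_sq_le_of_mem_modelCrossCap hδ h ((hmodel p (hsmall h).le).1 hp)
      have h2 := le_of_sq_le_sq (h1.trans hδρ) hρ.le
      linarith
  · linarith [hFR ξ hξ]
  · rw [hgraph p ((hδδ'.trans hδ'ε).le.trans (pow_le_pow_left₀ hε.le hp 4)), hG₂ p.1 hp]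
  · have hc : ContinuousAt (fun p : ℂ × ℂ => ‖p.1‖) q := by fun_prop
    rcases lt_or_ge δ (‖q.1‖ ^ 4) with h | h
    · have hsub : ∀ᶠ x in 𝓝 q, x ∈ shearedCrossCap δ H → x ∈ {p : ℂ × ℂ | p.2 = G p.1} := by
        filter_upwards [continuousAt_const.eventually_lt (hc.pow 4) h] with x hx
        exact (hgraph x hx.le).1
      have hq0 : q.1 ≠ 0 := by
        rintro h0
        rw [h0, norm_zero] at h
        linarith
      exact eq_zero_of_mem_velocities_graph (hG.contDiffAt.differentiableAt (by simp))
        (hGne q.1 hq0 hqR) (velocities_subset hsub hv) (velocities_subset hsub hiv)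
    · have hsub : ∀ᶠ x in 𝓝 q, x ∈ shearedCrossCap δ H → x ∈ modelCrossCap δ := by
        filter_upwards [hc.eventually_lt continuousAt_const (hsmall h)] with x hx
        exact (hmodel x hx.le).1
      exact eq_zero_of_mem_velocities_modelCrossCap hδ ((hmodel q (hsmall h).le).1 hq)
        (velocities_subset hsub hv) (velocities_subset hsub hiv)

end LocalBlowup

/-! ### Existence of totally real blow-ups -/

section Existence

variable {M : Type*} [TopologicalSpace M] [ChartedSpace (ℂ × ℂ) M] {S S' : Set M} {γ p : M}

theorem dbar_comp_add_right (F : ℂ → ℂ) (a z : ℂ) :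
    dbar (fun ξ => F (ξ + a)) z = dbar F (z + a) := by
  rw [dbar, dbar, fderiv_comp_add_right]

/-- Holomorphic coordinates centred at an isolated complex point, in which the surface is the graph
of a globally defined smooth function. -/
theorem HasComplexIndex.exists_centred_chart {k : ℤ} (h : HasComplexIndex S γ k) (hγ : γ ∈ S) :
    ∃ e ∈ IsManifold.maximalAtlas 𝓘(ℂ, ℂ × ℂ) ω M, ∃ F : ℂ → ℂ, γ ∈ e.source ∧ e γ = 0 ∧
      ContDiff ℝ ∞ F ∧ F 0 = 0 ∧ (∀ᶠ x in 𝓝 γ, x ∈ S ↔ (e x).2 = F (e x).1) ∧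
      ∀ᶠ r : ℝ in 𝓝[>] 0,
        HasWindingNumber (fun t => dbar F (r * Complex.exp (t * Complex.I))) k := by
  obtain ⟨φ, hφ, F, hγφ, hF, hS, hw⟩ := h
  have hγF : (φ γ).2 = F (φ γ).1 := hS.self_of_nhds.1 hγ
  let τ : OpenPartialHomeomorph (ℂ × ℂ) (ℂ × ℂ) :=
    (Homeomorph.addRight (-(φ γ))).toOpenPartialHomeomorph
  have hτ : τ ∈ contDiffGroupoid ω 𝓘(ℂ, ℂ × ℂ) :=
    mem_contDiffGroupoid_self_iff.2 ⟨(contDiff_id.add contDiff_const).contDiffOn,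
      (contDiff_id.add contDiff_const).contDiffOn⟩
  let F₁ : ℂ → ℂ := fun z => F (z + (φ γ).1) - (φ γ).2
  obtain ⟨R, hR, hFR⟩ : ∃ R > 0, ∀ z : ℂ, ‖z‖ < R → ContDiffAt ℝ ∞ F₁ z := by
    obtain ⟨R, hR, hFR⟩ := Metric.eventually_nhds_iff.1 hF
    refine ⟨R, hR, fun z hz => ContDiffAt.sub ?_ contDiffAt_const⟩
    refine ContDiffAt.comp (g := F) z (hFR ?_) (contDiffAt_id.add contDiffAt_const)
    simpa [dist_eq_norm] using hz
  -- The cut-off makes the function globally smooth without changing it near `0`, where the index is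
  -- read.
  let χ : ℂ → ℝ := fun z => 1 - radialCut (R / 3) (R / 2) z
  have hχ1 : ∀ z : ℂ, ‖z‖ ≤ R / 3 → χ z = 1 := fun z hz => by
    simp [χ, radialCut_eq_zero (by positivity : 0 ≤ R / 3) (by linarith : R / 3 < R / 2) hz]
  have hχ0 : ∀ z : ℂ, R / 2 ≤ ‖z‖ → χ z = 0 := fun z hz => by
    simp [χ, radialCut_eq_one (by positivity : 0 ≤ R / 3) (by linarith : R / 3 < R / 2) hz]
  let F₂ : ℂ → ℂ := fun z => χ z * F₁ z
  have hF₂ : ContDiff ℝ ∞ F₂ := by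
    rw [contDiff_iff_contDiffAt]
    intro z
    rcases lt_or_ge ‖z‖ R with hz | hz
    · exact (Complex.ofRealCLM.contDiff.comp
        (contDiff_const.sub contDiff_radialCut)).contDiffAt.mul (hFR z hz)
    · refine (contDiffAt_const (c := (0 : ℂ))).congr_of_eventuallyEq ?_
      filter_upwards [continuousAt_const.eventually_lt continuous_norm.continuousAt
        (show R / 2 < ‖z‖ by linarith)] with y hy
      simp [F₂, hχ0 y hy.le]
  have hF₂₁ : ∀ z : ℂ, ‖z‖ < R / 3 → F₂ z = F₁ z := fun z hz => by simp [F₂, hχ1 z hz.le]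
  have hball : ∀ z : ℂ, ‖z‖ < R / 3 → F₂ =ᶠ[𝓝 z] F₁ := fun z hz => by
    filter_upwards [continuous_norm.continuousAt.eventually_lt continuousAt_const hz] with y hy
      using hF₂₁ y hy
  have he : ∀ x, (φ.trans τ) x = φ x - φ γ := fun x => (sub_eq_add_neg _ _).symm
  refine ⟨φ.trans τ, trans_mem_maximalAtlas hφ hτ, F₂, by simpa [τ] using hγφ, by simp [he], hF₂,
    ?_, ?_, ?_⟩
  · rw [hF₂₁ 0 (by simpa using hR)]
    simp [F₁, hγF]
  · have hc : ContinuousAt (fun x => ‖(φ x).1 - (φ γ).1‖) γ := by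
      have := (φ.continuousAt hγφ).fst
      exact (this.sub continuousAt_const).norm
    filter_upwards [hS, hc.eventually_lt continuousAt_const
      (show ‖(φ γ).1 - (φ γ).1‖ < R / 3 by rw [sub_self, norm_zero]; positivity)] with x hx hxR
    rw [hx, he, Prod.fst_sub, Prod.snd_sub, hF₂₁ _ hxR]
    simp [F₁]
  · filter_upwards [hw, Ioo_mem_nhdsGT (show (0 : ℝ) < R / 3 by positivity)] with r hr hrR
    convert hr using 2 with t
    have hnorm : ‖(r * Complex.exp (t * Complex.I) : ℂ)‖ < R / 3 := by
      rw [norm_mul, Complex.norm_exp_ofReal_mul_I, mul_one, Complex.norm_real,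
        Real.norm_of_nonneg hrR.1.le]
      exact hrR.2
    rw [dbar_congr (hball _ hnorm), add_comm (φ γ).1, ← dbar_comp_add_right]
    simp only [dbar, F₁, fderiv_sub_const]

/-- The existence of a flattening chart at a point is a local property. -/
theorem exists_flat_chart_congr (h : ∀ᶠ x in 𝓝 p, x ∈ S' ↔ x ∈ S)
    (hS : ∃ φ ∈ IsManifold.maximalAtlas 𝓘(ℝ, ℂ × ℂ) ∞ M,
      p ∈ φ.source ∧ ∀ x ∈ φ.source, x ∈ S ↔ (φ x).2 = 0) :
    ∃ φ ∈ IsManifold.maximalAtlas 𝓘(ℝ, ℂ × ℂ) ∞ M,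
      p ∈ φ.source ∧ ∀ x ∈ φ.source, x ∈ S' ↔ (φ x).2 = 0 := by
  obtain ⟨φ, hφ, hpφ, hφS⟩ := hS
  obtain ⟨O, hO, hOo, hpO⟩ := eventually_nhds_iff.1 h
  refine ⟨φ.restr O, restr_mem_maximalAtlas _ hφ hOo, ?_, ?_⟩
  · rw [φ.restr_source' O hOo]
    exact ⟨hpφ, hpO⟩
  · intro x hx
    rw [φ.restr_source' O hOo] at hx
    exact (hO x hx.2).trans (hφS x hx.1)

variable [T2Space M] [IsManifold 𝓘(ℂ, ℂ × ℂ) ω M]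

/-- The local cross-cap is transported by a holomorphic chart. Outside `‖ξ‖ < ε` it coincides with
the graph, so the pieces fit smoothly. -/
theorem IsEmbeddedSurface.exists_isTotallyRealBlowup (hS : IsEmbeddedSurface S)
    (hγ : IsHyperbolicPoint S γ) {U : Set M} (hU : U ∈ 𝓝 γ) :
    ∃ S', IsTotallyRealBlowup S γ U S' := by
  obtain ⟨hγc, hiso, hind⟩ := hγ
  have hidx : HasComplexIndex S γ (-1) := by
    unfold complexIndex at hind
    -- The default index is `0`, not `-1`, so coordinates realizing the index do exist.
    split_ifs at hind with h
    exact hind ▸ h.choose_spec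
  obtain ⟨e, he, F, hγe, heγ, hF, hF0, hSF, hw⟩ := hidx.exists_centred_chart hγc.1
  have hiso' : ∀ᶠ x in 𝓝 γ, x ∈ complexPoints S → x = γ := by
    filter_upwards [eventually_nhdsWithin_iff.1 hiso] with x hx hxc
    by_contra hne
    exact hx hne hxc
  have hnear : ∀ᶠ x in 𝓝 γ, x ∈ U ∧ (x ∈ S ↔ (e x).2 = F (e x).1) ∧
      (x ∈ complexPoints S → x = γ) :=
    Filter.Eventually.and hU (hSF.and hiso')
  obtain ⟨R₀, hR₀, hball⟩ : ∃ R₀ > 0, ∀ q : ℂ × ℂ, ‖q.1‖ < R₀ → ‖q.2‖ < R₀ → q ∈ e.target ∧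
      (e.symm q ∈ U ∧ (e.symm q ∈ S ↔ (e (e.symm q)).2 = F (e (e.symm q)).1) ∧
        (e.symm q ∈ complexPoints S → e.symm q = γ)) := by
    have h0 : (0 : ℂ × ℂ) ∈ e.target := heγ ▸ e.map_source hγe
    have hsymm : e.symm 0 = γ := by rw [← heγ, e.left_inv hγe]
    have hev : ∀ᶠ q in 𝓝 (0 : ℂ × ℂ), q ∈ e.target ∧ (e.symm q ∈ U ∧
        (e.symm q ∈ S ↔ (e (e.symm q)).2 = F (e (e.symm q)).1) ∧
        (e.symm q ∈ complexPoints S → e.symm q = γ)) :=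
      Filter.Eventually.and (e.open_target.mem_nhds h0)
        ((e.symm.continuousAt h0).eventually (by rwa [hsymm]))
    obtain ⟨R₀, hR₀, h⟩ := Metric.eventually_nhds_iff.1 hev
    refine ⟨R₀, hR₀, fun q h1 h2 => h ?_⟩
    rw [dist_zero_right, Prod.norm_def]
    exact max_lt h1 h2
  obtain ⟨T, R, ε, hε, hεR, hRR₀, hTR₀, hFR₀, hTF, hTflat, hTreal, k, hk, hkinj, hkimg, hkbd⟩ :=
    exists_local_crossCap hF hF0 hw hR₀
  let W : Set M := e.source ∩ e ⁻¹' {q | ‖q.1‖ < R ∧ ‖q.2‖ < R₀}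
  have hWo : IsOpen W := e.continuousOn.isOpen_inter_preimage e.open_source
    ((isOpen_lt (continuous_norm.comp continuous_fst) continuous_const).inter
      (isOpen_lt (continuous_norm.comp continuous_snd) continuous_const))
  have hWspec : ∀ x ∈ W, x ∈ U ∧ (x ∈ S ↔ (e x).2 = F (e x).1) ∧
      (x ∈ complexPoints S → x = γ) := by
    rintro x ⟨hx, h1, h2⟩
    have := (hball (e x) (h1.trans_le hRR₀) h2).2
    rwa [e.left_inv hx] at this
  have himg : ∀ {P : Set (ℂ × ℂ)}, (∀ q ∈ P, ‖q.1‖ < R ∧ ‖q.2‖ < R₀) → P ⊆ e.target ∧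
      ∀ x, x ∈ e.symm '' P ↔ x ∈ W ∧ e x ∈ P := by
    intro P hP
    have hPt : P ⊆ e.target := fun q hq => (hball q ((hP q hq).1.trans_le hRR₀) (hP q hq).2).1
    refine ⟨hPt, fun x => ⟨?_, ?_⟩⟩
    · rintro ⟨q, hq, rfl⟩
      have hq' := hPt hq
      refine ⟨⟨e.map_target hq', ?_⟩, ?_⟩
      · rw [mem_preimage, e.right_inv hq']
        exact hP q hq
      · rwa [e.right_inv hq']
    · rintro ⟨hx, hxP⟩
      exact ⟨e x, hxP, e.left_inv hx.1⟩
  have hFbox : ∀ q : ℂ × ℂ, q.2 = F q.1 → ‖q.1‖ ≤ ε → ‖q.1‖ < R ∧ ‖q.2‖ < R₀ := fun q h1 h2 =>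
    ⟨h2.trans_lt hεR, h1 ▸ hFR₀ _ (h2.trans_lt hεR)⟩
  let PD : Set (ℂ × ℂ) := {q | q.2 = F q.1 ∧ ‖q.1‖ ≤ ε}
  let PD₀ : Set (ℂ × ℂ) := {q | q.2 = F q.1 ∧ ‖q.1‖ < ε}
  let PC : Set (ℂ × ℂ) := {q | q ∈ T ∧ ‖q.1‖ ≤ ε}
  obtain ⟨hPD, hD⟩ := himg (P := PD) fun q hq => hFbox q hq.1 hq.2
  obtain ⟨hPD₀, hD₀⟩ := himg (P := PD₀) fun q hq => hFbox q hq.1 hq.2.le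
  obtain ⟨hPC, hC⟩ := himg (P := PC) fun q hq =>
    ⟨hq.2.trans_lt hεR, hTR₀ q hq.1 (hq.2.trans_lt hεR)⟩
  have hbdry : e.symm '' PD \ e.symm '' PD₀ = e.symm '' {q | q ∈ T ∧ ‖q.1‖ = ε} := by
    have hPB : {q : ℂ × ℂ | q ∈ T ∧ ‖q.1‖ = ε} = {q | q.2 = F q.1 ∧ ‖q.1‖ = ε} := by
      ext q
      exact and_congr_left fun h => hTF q h.ge
    rw [hPB]
    ext x
    rw [Set.mem_sdiff, hD, hD₀, (himg (P := {q : ℂ × ℂ | q.2 = F q.1 ∧ ‖q.1‖ = ε})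
      fun q hq => hFbox q hq.1 hq.2.le).2]
    constructor
    · rintro ⟨⟨hx, h1, h2⟩, h3⟩
      exact ⟨hx, h1, le_antisymm h2 (not_lt.1 fun h4 => h3 ⟨hx, h1, h4⟩)⟩
    · rintro ⟨hx, h1, h2⟩
      exact ⟨⟨hx, h1, h2.le⟩, fun h3 => h3.2.2.ne h2⟩
  have hdisc : IsClosedDisc (e.symm '' PD) (e.symm '' PD₀) := by
    let d : ℂ → ℂ × ℂ := fun z => (ε * z, F (ε * z))
    have hd : Continuous d := by
      have := hF.continuous
      fun_prop
    have hnorm : ∀ z : ℂ, ‖(ε * z : ℂ)‖ = ε * ‖z‖ := fun z => by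
      rw [norm_mul, Complex.norm_real, Real.norm_of_nonneg hε.le]
    have hεC : (ε : ℂ) ≠ 0 := by exact_mod_cast hε.ne'
    have hdimg : d '' Metric.closedBall 0 1 = PD := by
      ext q
      constructor
      · rintro ⟨z, hz, rfl⟩
        refine ⟨rfl, ?_⟩
        have hz' : ‖z‖ ≤ 1 := by simpa using hz
        simp only [d, hnorm]
        nlinarith
      · rintro ⟨h1, h2⟩
        refine ⟨q.1 / ε, ?_, ?_⟩
        · rw [mem_closedBall_zero_iff, norm_div, Complex.norm_real, Real.norm_of_nonneg hε.le]
          exact div_le_one_of_le₀ h2 hε.le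
        · simp only [d, mul_div_cancel₀ _ hεC, ← h1]
    have hdimg₀ : d '' Metric.ball 0 1 = PD₀ := by
      ext q
      constructor
      · rintro ⟨z, hz, rfl⟩
        refine ⟨rfl, ?_⟩
        have hz' : ‖z‖ < 1 := by simpa using hz
        simp only [d, hnorm]
        nlinarith
      · rintro ⟨h1, h2⟩
        refine ⟨q.1 / ε, ?_, ?_⟩
        · rw [mem_ball_zero_iff, norm_div, Complex.norm_real, Real.norm_of_nonneg hε.le]
          exact (div_lt_one hε).2 h2
        · simp only [d, mul_div_cancel₀ _ hεC, ← h1]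
    have hmaps : MapsTo d (Metric.closedBall 0 1) e.target := fun z hz =>
      hPD (hdimg ▸ mem_image_of_mem d hz)
    refine ⟨e.symm ∘ d, e.symm.continuousOn.comp hd.continuousOn hmaps,
      e.symm.injOn.comp (fun z _ z' _ h => ?_) hmaps, ?_, ?_⟩
    · exact mul_left_cancel₀ hεC (congrArg Prod.fst h)
    · rw [image_comp, hdimg]
    · rw [image_comp, hdimg₀]
  have hcross : IsCrossCap (e.symm '' PC) (e.symm '' PD \ e.symm '' PD₀) := by
    have hmaps : MapsTo k crossCap e.target := fun z hz => hPC (hkimg.subset (mem_image_of_mem k hz))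
    refine ⟨e.symm ∘ k, e.symm.continuousOn.comp hk.continuousOn hmaps,
      e.symm.injOn.comp hkinj hmaps, ?_, ?_⟩
    · rw [image_comp, hkimg]
    · rw [image_comp, hkbd, hbdry]
  let S' : Set M := (S \ e.symm '' PD₀) ∪ e.symm '' PC
  -- Within the box `W` the new surface is all of `T`, not only its part over `‖ξ‖ ≤ ε`. This gives
  -- flattening charts and tangent planes across the seam.
  have hS'W : ∀ x ∈ W, x ∈ S' ↔ e x ∈ T := by
    intro x hx
    have h1 := (hWspec x hx).2.1
    simp only [S', mem_union, Set.mem_sdiff]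
    rw [hD₀, hC, h1]
    rcases lt_or_ge ‖(e x).1‖ ε with h2 | h2
    · simp [hx, PD₀, PC, h2, h2.le]
    · have h3 := hTF (e x) h2
      simp only [hx, true_and, PD₀, PC, mem_ofPred_eq, h3, not_lt.2 h2, and_false, not_false_eq_true,
        and_true, or_iff_left_iff_imp]
      exact fun h => h.1
  have hDW : ∀ x ∈ e.symm '' PD, x ∈ W := fun x hx => ((hD x).1 hx).1
  have hCW : ∀ x ∈ e.symm '' PC, x ∈ W := fun x hx => ((hC x).1 hx).1
  have hD₀D : e.symm '' PD₀ ⊆ e.symm '' PD := image_mono fun q hq => ⟨hq.1, hq.2.le⟩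
  have heR := maximalAtlas_complex_subset_real he
  refine ⟨S', fun p hp => ?_, e.symm '' PD, e.symm '' PD₀, e.symm '' PC,
    ⟨hdisc, fun x hx => ?_, hcross, ?_, rfl⟩, ?_, fun x hx => (hWspec x (hDW x hx)).1,
    fun x hx => (hWspec x (hCW x hx)).1, fun x hx => (hWspec x (hDW x hx.1)).2.2 hx.2,
    fun p hp v hv hiv => ?_⟩
  · by_cases hpW : p ∈ W
    · obtain ⟨ψ, hψ, hpψ, hψT⟩ := hTflat (e p) ((hS'W p hpW).1 hp)
      have hcongr : ∀ᶠ x in 𝓝 p, x ∈ S' ↔ x ∈ e.source ∧ e x ∈ T := by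
        filter_upwards [hWo.mem_nhds hpW] with x hx
        rw [hS'W x hx]
        exact (and_iff_right hx.1).symm
      refine exists_flat_chart_congr (S := {x | x ∈ e.source ∧ e x ∈ T}) hcongr
        ⟨e.trans ψ, trans_mem_maximalAtlas heR hψ, ?_, fun x hx => ?_⟩
      · rw [OpenPartialHomeomorph.trans_source]
        exact ⟨hpW.1, hpψ⟩
      · rw [OpenPartialHomeomorph.trans_source] at hx
        exact (and_iff_right hx.1).trans (hψT _ hx.2)
    · have hpD : p ∉ e.symm '' PD := fun h => hpW (hDW p h)
      have hpC : p ∉ e.symm '' PC := fun h => hpW (hCW p h)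
      have hpS : p ∈ S := (hp.resolve_right hpC).1
      exact exists_flat_chart_congr (eventually_mem_iff_of_notMem hdisc.isCompact hD₀D
        hcross.isCompact rfl hpD hpC) (hS p hpS)
  · exact (hWspec x (hDW x hx)).2.1.2 ((hD x).1 hx).2.1
  · refine Subset.antisymm ?_ ?_
    · rintro x ⟨hxC, hxS, hxD₀⟩
      obtain ⟨hxW, hxT, hxε⟩ := (hC x).1 hxC
      exact ⟨(hD x).2 ⟨hxW, (hWspec x hxW).2.1.1 hxS, hxε⟩, hxD₀⟩
    · rintro x ⟨hxD, hxD₀⟩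
      refine ⟨hcross.boundary_subset ⟨hxD, hxD₀⟩, ?_, hxD₀⟩
      obtain ⟨hxW, hxF, -⟩ := (hD x).1 hxD
      exact (hWspec x hxW).2.1.2 hxF
  · refine (hD₀ γ).2 ⟨⟨hγe, ?_⟩, ?_, ?_⟩
    · rw [mem_preimage, heγ]
      simpa using ⟨hε.trans hεR, hR₀⟩
    · rw [heγ]
      exact hF0.symm
    · rw [heγ]
      simpa using hε
  · obtain ⟨hpW, hpT, hpε⟩ := (hC p).1 hp
    -- Tangent planes are read in the preferred chart at `p`, but `T` lives in `e`. Both charts are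
    -- holomorphic, so `A` commutes with `i` and preserves total reality.
    obtain ⟨A, hA⟩ := exists_transition_derivative (𝕜 := ℂ) (by simp)
      (IsManifold.chart_mem_maximalAtlas (I := 𝓘(ℂ, ℂ × ℂ)) (n := ω) p) he
      (mem_chart_source (ℂ × ℂ) p) hpW.1
    have hvel : ∀ w ∈ tangentPlane S' p, A w ∈ velocities T (e p) := by
      rintro w ⟨c, hc0, hc, hcS', hw⟩
      refine ⟨fun t => e (c t), by simp [hc0], ?_, (hA c hc0 hc w).1 hw⟩
      filter_upwards [hcS', hc.preimage_mem_nhds (hWo.mem_nhds (hc0 ▸ hpW))] with t h1 h2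
      exact (hS'W _ h2).1 h1
    have h0 := hTreal (e p) hpT (hpε.trans_lt hεR) (A v) (hvel v hv) (by
      rw [← map_smul]
      exact hvel _ hiv)
    simpa using h0

end Existence

end TotallyRealBlowup

end

theorem mainTheorem2 {M : Type*} [TopologicalSpace M] [T2Space M] [ChartedSpace (ℂ × ℂ) M]
    [IsManifold 𝓘(ℂ, ℂ × ℂ) ω M]
    (S : Set M) (hS : TotallyRealBlowup.IsEmbeddedSurface S)
    (γ : M) (hγ : TotallyRealBlowup.IsHyperbolicPoint S γ) :
    (∀ U ∈ 𝓝 γ, ∃ S' : Set M, TotallyRealBlowup.IsTotallyRealBlowup S γ U S' ∧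
      (TotallyRealBlowup.complexPoints S = {γ} → TotallyRealBlowup.IsTotallyReal S')) ∧
    (∀ U S' : Set M, TotallyRealBlowup.IsTotallyRealBlowup S γ U S' →
      TotallyRealBlowup.complexPoints S' = TotallyRealBlowup.complexPoints S \ {γ} ∧
      (∀ p ∈ TotallyRealBlowup.complexPoints S',
        TotallyRealBlowup.complexIndex S' p = TotallyRealBlowup.complexIndex S p) ∧
      ((TotallyRealBlowup.complexPoints S).Finite →
        TotallyRealBlowup.complexIndexSum S' = TotallyRealBlowup.complexIndexSum S + 1)) := by
  refine ⟨fun U hU => ?_, fun U S' h => ?_⟩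
  · obtain ⟨S', hS'⟩ := hS.exists_isTotallyRealBlowup hγ hU
    exact ⟨S', hS', hS'.isTotallyReal⟩
  · obtain ⟨h₁, h₂⟩ := h.complexPoints_and_index
    exact ⟨h₁, h₂, h.complexIndexSum_eq hγ⟩
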